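/- Theorem. Let $X$ be an open subset of $\mathbb R^n$ (or an $n$-dimensional smooth manifold) and consider a DAE $\Xi_{l,n}=(E,F)$: $E(x)\dot x=F(x)$ on $X$, where $E:TX\to\mathbb R^l$ is a smooth $\mathbb R^l$-valued differential 1-form, $F:X\to\mathbb R^l$ is smooth, and "smooth" means $C^\infty$. Let $x_p\in X$. The following statements are equivalent: (i) There is an open neighbourhood of $x_p$ on which $\operatorname{rank}E(x)$ is constant and the distribution $\ker E$ is involutive (closed under Lie brackets of smooth vector fields). (ii) $\Xi$ is, around $x_p$, locally externally equivalent to a semi-explicit DAE $\dot x_1=F_1(x_1,x_2)$, $0=F_2(x_1,x_2)$ with $x_1\in X_1\subseteq\mathbb R^q$, $x_2\in X_2\subseteq\mathbb R^{n-q}$ ($X_1,X_2$ open) and smooth $F_1:X_1\times X_2\to\mathbb R^q$, $F_2:X_1\times X_2\to\mathbb R^{l-q}$, for some $0\le q\le\min(n,l)$. (iii) Explicitations of $\Xi$ around $x_p$ exist, and every explicitation of $\Xi$ around $x_p$ can be fully reduced around $x_p$. Here: - Two DAEs $(E,F)$ on $X$ and $(\tilde E,\tilde F)$ on $\tilde X$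 with the same $l,n$ are locally externally equivalent around $x_p$ if there are a diffeomorphism $\psi$ from an open neighbourhood $U\subseteq X$ of $x_p$ onto an open subset of $\tilde X$ and a smooth $Q:U\to GL(l,\mathbb R)$ with $\psi^*\tilde E=QE$ and $\psi^*\tilde F=QF$ on $U$. - An explicitation of $\Xi$ around $x_p$ is a smooth control system $\dot x=f(x)+\sum_{i=1}^m g_i(x)v_i$, $y=h(x)\in\mathbb R^p$ on an open neighbourhood $U\subseteq X$ of $x_p$ such that, for some $q$ with $m=n-q$ and $p=l-q$ and some smooth $Q:U\to GL(l,\mathbb R)$, one has on $U$: $QE=\begin{bmatrix}E_1\\0\end{bmatrix}$, where $E_1$ has $q$ rows and full row rank, $QF=\begin{bmatrix}F_1\\F_2\end{bmatrix}$, $f=E_1^\dagger F_1$ for a smooth right inverse $E_1^\dagger$ of $E_1$, $\operatorname{span}\{g_1,\dots,g_m\}=\ker E$, and $h=F_2$. - Let $\mathcal G=\operatorname{span}\{g_1,\dots,g_m\}$. A control system $(f,g,h)$ can be fully reduced around $x_p$ if, on a neighbourhood of $x_p$, $\mathcal G$ is an involutive distribution of some constant rank $k$, and there are local coordinates $(x_1,x_2)\in\mathbb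 R^{n-k}\times\mathbb R^k$ and a smooth feedback $v=\alpha(x)+\beta(x)\tilde v$ with $\beta$ invertible, $\tilde v=(v_1,v_2)\in\mathbb R^{m-k}\times\mathbb R^k$, such that $\mathcal G=\operatorname{span}\{\partial/\partial x_2^1,\dots,\partial/\partial x_2^k\}$ and the system becomes $\dot x_1=f_1(x_1,x_2)+\sum_{i=1}^{m-k}g_1^i(x_1,x_2)v_1^i$, $\dot x_2=v_2$, $y=h(x_1,x_2)$. -/

import Mathlib

open scoped Manifold ContDiff Topology Matrix

noncomputable section

namespace NonlinearDAE

section General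

variable {V : Type*} [NormedAddCommGroup V] [NormedSpace ℝ V]
  {H : Type*} [TopologicalSpace H] (I : ModelWithCorners ℝ V H)
  (M : Type*) [TopologicalSpace M] [ChartedSpace H M] [IsManifold I ∞ M]

/-- A (not necessarily smooth) vector field on `M`. -/
abbrev VField : Type _ := ∀ x : M, TangentSpace I x

/-- A distribution on `M`: a subspace of each tangent space. -/
abbrev Distribution : Type _ := ∀ x : M, Submodule ℝ (TangentSpace I x)

/-- A differential-algebraic equation `E(x) ẋ = F(x)` with `l` equations, defined on an open
subset `X` of the manifold `M` (take `M = ℝⁿ` for open subsets of `ℝⁿ`, and `X = M` for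
manifolds). `E` is a smooth `ℝˡ`-valued differential one-form on `X`, i.e. a smooth map
`TX → ℝˡ` that is linear in the fibres, and `F : X → ℝˡ` is smooth.
The values outside `X` are irrelevant. -/
structure DAE (l : ℕ) where
  /-- the domain of generalized states -/
  X : Set M
  isOpen_X : IsOpen X
  E : ∀ x : M, TangentSpace I x →L[ℝ] (Fin l → ℝ)
  F : M → Fin l → ℝ
  smooth_E : ContMDiffOn I.tangent 𝓘(ℝ, Fin l → ℝ) ∞
    (fun v : TangentBundle I M => E v.proj v.2) {v : TangentBundle I M | v.proj ∈ X}
  smooth_F : ContMDiffOn I 𝓘(ℝ, Fin l → ℝ) ∞ F X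

/-- A control system `ẋ = f(x) + ∑ᵢ gᵢ(x) vᵢ`, `y = h(x)` with `m` inputs and `p` outputs, whose
data are smooth on the open subset `X` of the manifold `M`. -/
structure ControlSystem (m p : ℕ) where
  /-- the domain of the states -/
  X : Set M
  isOpen_X : IsOpen X
  f : VField I M
  g : Fin m → VField I M
  h : M → Fin p → ℝ
  smooth_f : ContMDiffOn I I.tangent ∞ (fun x => (⟨x, f x⟩ : TangentBundle I M)) X
  smooth_g : ∀ i, ContMDiffOn I I.tangent ∞ (fun x => (⟨x, g i x⟩ : TangentBundle I M)) X
  smooth_h : ContMDiffOn I 𝓘(ℝ, Fin p → ℝ) ∞ h X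

variable {I M}

/-- The distribution `x ↦ ker E(x)` of a DAE. -/
def DAE.kerE {l : ℕ} (Ξ : DAE I M l) : Distribution I M :=
  fun x => LinearMap.ker (Ξ.E x : TangentSpace I x →ₗ[ℝ] (Fin l → ℝ))

/-- The rank of `E(x)`. -/
def DAE.rankE {l : ℕ} (Ξ : DAE I M l) (x : M) : ℕ :=
  Module.finrank ℝ (LinearMap.range (Ξ.E x : TangentSpace I x →ₗ[ℝ] (Fin l → ℝ)))

/-- The distribution `𝒢(x) = span {g₁(x), …, g_m(x)} = Im g(x)` of a control system. -/
def ControlSystem.G {m p : ℕ} (S : ControlSystem I M m p) : Distribution I M :=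
  fun x => Submodule.span ℝ (Set.range fun i => S.g i x)

/-- The distribution `D` is involutive on the open set `U`: the Lie bracket of any two smooth vector
fields that are defined on an open subset of `U` and belong to `D` belongs to `D` again. -/
def InvolutiveOn (D : Distribution I M) (U : Set M) : Prop :=
  ∀ W : Set M, IsOpen W → W ⊆ U → ∀ Y Z : VField I M,
    ContMDiffOn I I.tangent ∞ (fun x => (⟨x, Y x⟩ : TangentBundle I M)) W →
    ContMDiffOn I I.tangent ∞ (fun x => (⟨x, Z x⟩ : TangentBundle I M)) W →
    (∀ x ∈ W, Y x ∈ D x) → (∀ x ∈ W, Z x ∈ D x) →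
    ∀ x ∈ W, VectorField.mlieBracket I Y Z x ∈ D x

/-- `Q` is a smooth map from `U` to `GL(k, ℝ)`. -/
def IsSmoothGL {k : ℕ} (Q : M → Matrix (Fin k) (Fin k) ℝ) (U : Set M) : Prop :=
  (∀ i j, ContMDiffOn I 𝓘(ℝ, ℝ) ∞ (fun x => Q x i j) U) ∧ ∀ x ∈ U, IsUnit (Q x)

/-- `ψ` is a smooth diffeomorphism from the open set `ψ.source` to the open set `ψ.target`. -/
def IsLocalDiffeo
    {V' : Type*} [NormedAddCommGroup V'] [NormedSpace ℝ V']
    {H' : Type*} [TopologicalSpace H'] (I : ModelWithCorners ℝ V H) (I' : ModelWithCorners ℝ V' H')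
    {M' : Type*} [TopologicalSpace M'] [ChartedSpace H' M']
    (ψ : OpenPartialHomeomorph M M') : Prop :=
  ContMDiffOn I I' ∞ ψ ψ.source ∧ ContMDiffOn I' I ∞ ψ.symm ψ.target

/-- Local external equivalence of `Ξ` around `x₀` and `Ξ'` around `z₀`: there are a diffeomorphism
`ψ` from a neighbourhood `U` of `x₀` onto a neighbourhood of `z₀` with `ψ(x₀) = z₀`, and a smooth
`Q : U → GL(l, ℝ)`, such that `ψ^*E' = Q E` and `ψ^*F' = Q F`. -/
def LocallyExEquivalent
    {V' : Type*} [NormedAddCommGroup V'] [NormedSpace ℝ V']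
    {H' : Type*} [TopologicalSpace H'] {I' : ModelWithCorners ℝ V' H'}
    {M' : Type*} [TopologicalSpace M'] [ChartedSpace H' M'] [IsManifold I' ∞ M']
    {l : ℕ} (Ξ : DAE I M l) (x₀ : M) (Ξ' : DAE I' M' l) (z₀ : M') : Prop :=
  ∃ (ψ : OpenPartialHomeomorph M M') (Q : M → Matrix (Fin l) (Fin l) ℝ),
    IsLocalDiffeo I I' ψ ∧ IsSmoothGL (I := I) Q ψ.source ∧
    x₀ ∈ ψ.source ∧ ψ x₀ = z₀ ∧ ψ.source ⊆ Ξ.X ∧ ψ.target ⊆ Ξ'.X ∧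
    ∀ x ∈ ψ.source,
      (∀ v : TangentSpace I x, Ξ'.E (ψ x) (mfderiv I I' ψ x v) = Q x *ᵥ Ξ.E x v) ∧
      Ξ'.F (ψ x) = Q x *ᵥ Ξ.F x

/-- The stacked column vector `(a, b)`, where `a` has `q` and `b` has `p` entries, `q + p = l`. -/
def stack {q p l : ℕ} (hl : q + p = l) (a : Fin q → ℝ) (b : Fin p → ℝ) : Fin l → ℝ :=
  fun i => Fin.append a b (Fin.cast hl.symm i)

/-- `S` is a `(Q, v)`-explicitation of `Ξ` around `x₀`. On the neighbourhood `S.X` of `x₀`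
there are a smooth invertible `Q` with `Q E = (E₁, 0)`, `Q F = (F₁, F₂)`, where `E₁` and `F₁` have
`q` rows, and a smooth right inverse `E₁r` of `E₁` (so `E₁` has full row rank `q` and
`rank E = q` on `S.X`) with `f = E₁r F₁`, `Im g = ker E`, `h = F₂`; moreover `m = n - q`
and `p = l - q`, where `n` is the dimension of `M`. -/
def IsExplicitation {l m p : ℕ} (Ξ : DAE I M l) (x₀ : M) (S : ControlSystem I M m p) : Prop :=
  x₀ ∈ S.X ∧ S.X ⊆ Ξ.X ∧
  ∃ (q : ℕ) (hl : q + p = l) (Q : M → Matrix (Fin l) (Fin l) ℝ)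
    (E₁ : ∀ x : M, TangentSpace I x →L[ℝ] (Fin q → ℝ)) (F₁ : M → Fin q → ℝ)
    (E₁r : ∀ x : M, (Fin q → ℝ) →L[ℝ] TangentSpace I x),
    q + m = Module.finrank ℝ V ∧
    IsSmoothGL (I := I) Q S.X ∧
    (∀ w : Fin q → ℝ,
      ContMDiffOn I I.tangent ∞ (fun x => (⟨x, E₁r x w⟩ : TangentBundle I M)) S.X) ∧
    ∀ x ∈ S.X,
      (∀ v : TangentSpace I x, Q x *ᵥ Ξ.E x v = stack hl (E₁ x v) 0) ∧
      Q x *ᵥ Ξ.F x = stack hl (F₁ x) (S.h x) ∧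
      (∀ w : Fin q → ℝ, E₁ x (E₁r x w) = w) ∧
      S.f x = E₁r x (F₁ x) ∧
      S.G x = Ξ.kerE x

/-- The control system `S` can (around `x₀`) be `D`-reduced, where `D` is, around `x₀`, an
involutive sub-distribution of constant rank `k` of `𝒢 = span {g₁, …, g_m}`. On a neighbourhood
of `x₀` there are a coordinate change `ψ(x) = (x₁, x₂) ∈ ℝᵈ × ℝᵏ` and a feedback transformation
`v = α(x) + β(x) ṽ`, `ṽ = (v₁, v₂) ∈ ℝ^(m-k) × ℝᵏ`, with `β` invertible, such that
`D = span {∂/∂x₂¹, …, ∂/∂x₂ᵏ}` and `S` becomes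
`ẋ₁ = f₁(x₁, x₂) + ∑ᵢ g₁ⁱ(x₁, x₂) v₁ⁱ`, `ẋ₂ = v₂`, `y = h₁(x₁, x₂)`;
the reduced system consists of the first and the third of these equations, with state `x₁` and
inputs `v₁`, `x₂`. -/
def CanBeReduced {m p : ℕ} (S : ControlSystem I M m p) (x₀ : M) (k : ℕ)
    (D : Distribution I M) : Prop :=
  (∃ U : Set M, IsOpen U ∧ x₀ ∈ U ∧ U ⊆ S.X ∧ InvolutiveOn D U ∧
    ∀ x ∈ U, D x ≤ S.G x ∧ Module.finrank ℝ (D x) = k) ∧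
  ∃ (hk : k ≤ m) (d : ℕ)
    (ψ : OpenPartialHomeomorph M (EuclideanSpace ℝ (Fin d) × EuclideanSpace ℝ (Fin k)))
    (α : M → Fin m → ℝ) (β : M → Matrix (Fin m) (Fin m) ℝ)
    (f₁ : EuclideanSpace ℝ (Fin d) × EuclideanSpace ℝ (Fin k) → EuclideanSpace ℝ (Fin d))
    (g₁ : Fin (m - k) → EuclideanSpace ℝ (Fin d) × EuclideanSpace ℝ (Fin k) →
      EuclideanSpace ℝ (Fin d))
    (h₁ : EuclideanSpace ℝ (Fin d) × EuclideanSpace ℝ (Fin k) → Fin p → ℝ),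
    d + k = Module.finrank ℝ V ∧
    IsLocalDiffeo I 𝓘(ℝ, EuclideanSpace ℝ (Fin d) × EuclideanSpace ℝ (Fin k)) ψ ∧
    x₀ ∈ ψ.source ∧ ψ.source ⊆ S.X ∧
    ContMDiffOn I 𝓘(ℝ, Fin m → ℝ) ∞ α ψ.source ∧
    IsSmoothGL (I := I) β ψ.source ∧
    ContDiffOn ℝ ∞ f₁ ψ.target ∧ (∀ i, ContDiffOn ℝ ∞ (g₁ i) ψ.target) ∧
    ContDiffOn ℝ ∞ h₁ ψ.target ∧
    ∀ x ∈ ψ.source, ∀ dψ : TangentSpace I x →L[ℝ]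
        (EuclideanSpace ℝ (Fin d) × EuclideanSpace ℝ (Fin k)),
      dψ = mfderiv I 𝓘(ℝ, EuclideanSpace ℝ (Fin d) × EuclideanSpace ℝ (Fin k)) ψ x →
      -- `D` is spanned by the coordinate vector fields of `x₂`
      (∀ v : TangentSpace I x, v ∈ D x ↔ (dψ v).1 = 0) ∧
      -- the transformed drift `f + g α`
      dψ (S.f x + ∑ a, α x a • S.g a x) = (f₁ (ψ x), 0) ∧
      -- the columns of the transformed input matrix `g β` that are multiplied by `v₁`
      (∀ i : Fin (m - k),
        dψ (∑ a, β x a ⟨i, by omega⟩ • S.g a x) = (g₁ i (ψ x), 0)) ∧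
      -- the columns of `g β` that are multiplied by `v₂`
      (∀ j : Fin k,
        dψ (∑ a, β x a ⟨m - k + j, by omega⟩ • S.g a x) = (0, EuclideanSpace.single j 1)) ∧
      S.h x = h₁ (ψ x)

/-- The control system `S` can be fully reduced around `x₀`: it can be `𝒢`-reduced, where
`𝒢 = span {g₁, …, g_m}`. -/
def CanBeFullyReduced {m p : ℕ} (S : ControlSystem I M m p) (x₀ : M) : Prop :=
  ∃ k : ℕ, CanBeReduced S x₀ k S.G

end General

theorem stack_smooth {W : Type*} [NormedAddCommGroup W] [NormedSpace ℝ W] {q p l : ℕ}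
    (hl : q + p = l) {U : Set W} {a : W → Fin q → ℝ} {b : W → Fin p → ℝ}
    (ha : ContDiffOn ℝ ∞ a U) (hb : ContDiffOn ℝ ∞ b U) :
    ContDiffOn ℝ ∞ (fun x => stack hl (a x) (b x)) U := by
  subst hl
  rw [contDiffOn_pi] at ha hb ⊢
  intro i
  refine Fin.addCases (fun j => ?_) (fun j => ?_) i
  · simpa [stack] using ha j
  · simpa [stack] using hb j

/-- The linear map `(v₁, v₂) ↦ (v₁, 0)` from `ℝ^q × ℝ^m` to `ℝˡ = ℝ^q × ℝ^p`. -/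
def semiExplicitE {q p l : ℕ} (m : ℕ) (hl : q + p = l) :
    EuclideanSpace ℝ (Fin q) × EuclideanSpace ℝ (Fin m) →L[ℝ] (Fin l → ℝ) :=
  LinearMap.toContinuousLinearMap
    { toFun := fun v => stack hl (fun i => v.1 i) 0
      map_add' := by
        intro v w
        subst hl
        funext i
        refine Fin.addCases (fun j => ?_) (fun j => ?_) i <;> simp [stack]
      map_smul' := by
        intro c v
        subst hl
        funext i
        refine Fin.addCases (fun j => ?_) (fun j => ?_) i <;> simp [stack] }

/-- The semi-explicit DAE `ẋ₁ = F₁(x₁, x₂)`, `0 = F₂(x₁, x₂)` with `x₁ ∈ X₁ ⊆ ℝ^q` and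
`x₂ ∈ X₂ ⊆ ℝ^m`, where `X₁`, `X₂` are open; `F₁` has `q` and `F₂` has `p = l - q` entries. -/
def semiExplicit {q m p l : ℕ} (hl : q + p = l)
    (X₁ : TopologicalSpace.Opens (EuclideanSpace ℝ (Fin q)))
    (X₂ : TopologicalSpace.Opens (EuclideanSpace ℝ (Fin m)))
    (F₁ : EuclideanSpace ℝ (Fin q) × EuclideanSpace ℝ (Fin m) → Fin q → ℝ)
    (F₂ : EuclideanSpace ℝ (Fin q) × EuclideanSpace ℝ (Fin m) → Fin p → ℝ)
    (hF₁ : ContDiffOn ℝ ∞ F₁ ((X₁ : Set _) ×ˢ (X₂ : Set _)))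
    (hF₂ : ContDiffOn ℝ ∞ F₂ ((X₁ : Set _) ×ˢ (X₂ : Set _))) :
    DAE 𝓘(ℝ, EuclideanSpace ℝ (Fin q) × EuclideanSpace ℝ (Fin m))
      (EuclideanSpace ℝ (Fin q) × EuclideanSpace ℝ (Fin m)) l where
  X := (X₁ : Set _) ×ˢ (X₂ : Set _)
  isOpen_X := X₁.isOpen.prod X₂.isOpen
  E := fun _ => semiExplicitE m hl
  F := fun x => stack hl (F₁ x) (F₂ x)
  smooth_E := by
    have h1 : ContMDiff
        (𝓘(ℝ, EuclideanSpace ℝ (Fin q) × EuclideanSpace ℝ (Fin m)).tangent)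
        𝓘(ℝ, EuclideanSpace ℝ (Fin q) × EuclideanSpace ℝ (Fin m)) ∞
        (fun v : TangentBundle 𝓘(ℝ, EuclideanSpace ℝ (Fin q) × EuclideanSpace ℝ (Fin m))
          (EuclideanSpace ℝ (Fin q) × EuclideanSpace ℝ (Fin m)) =>
          (v.2 : EuclideanSpace ℝ (Fin q) × EuclideanSpace ℝ (Fin m))) := by
      intro v
      simpa using (Bundle.contMDiffAt_totalSpace.1
        (contMDiffAt_id (I := 𝓘(ℝ, EuclideanSpace ℝ (Fin q) × EuclideanSpace ℝ (Fin m)).tangent)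
          (n := ∞) (x := v))).2
    exact ((semiExplicitE m hl).contMDiff.comp h1).contMDiffOn
  smooth_F := (stack_smooth hl hF₁ hF₂).contMDiffOn

end NonlinearDAE

end

open NonlinearDAE

noncomputable section

universe u

/-! Everything hinges on a chart `ψ = (x₁, x₂)` that straightens `ker E`: `E v = 0` exactly when the
`x₁`-part of `dψ v` vanishes (`DAE.Flattens`). By Frobenius such a chart exists when `ker E` is
involutive of constant rank (`exists_flattens`).

From a straightening chart, (ii) follows by linear algebra with parameters. In the chart, `E`
restricted to the `x₁`-directions is injective; adding a constant complement makes it an invertible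
`l × l` family near the point, and its inverse is the required `Q`
(`DAE.Flattens.exists_semiExplicit`). Conversely, a semi-explicit form displays `ker E` as the span
of the `∂/∂x₂`, so its diffeomorphism is a straightening chart
(`LocallyExEquivalent.exists_flattens`), and `E₁ = dx₁` with the coordinate fields gives an
explicitation. For any explicitation, the `g` form a frame of `ker E`, so one feedback turns this
frame into `∂/∂x₂` and cancels the `x₂`-part of the drift (`DAE.Flattens.canBeFullyReduced`).
Finally, full reducibility contains involutivity and constant rank of `𝒢 = ker E`, which is (i) by
rank-nullity.

Frobenius is proved through total differential systems. Write the kernel as the graph of `A(x, y)`;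
involutivity becomes the integrability condition for `∂y/∂x = A(x, y)`. Solve along rays, `γ' = A(t
x, γ) x`, `γ(0) = y`, and put `Φ(x, y) = γ(1)`. Smooth dependence on `(x, y)` comes from the
implicit function theorem in the Banach space `C([0, 1], Y)`, where `γ ↦ f ∘ γ` is smooth
(`contDiff_superposition`). Integrability turns the error `∂γ/∂x · h - t A(t x, γ) h` into a
solution of a homogeneous linear equation with zero initial value, so `Φ` solves the system
(`exists_total_solution`). -/

namespace NonlinearDAE

/-! ### Smoothness of superposition operators on spaces of continuous curves. -/

section Superposition

variable {K : Type*} [TopologicalSpace K] [CompactSpace K]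
  {E F : Type*} [NormedAddCommGroup E] [NormedSpace ℝ E] [NormedAddCommGroup F] [NormedSpace ℝ F]

/-- A continuous family of continuous linear maps acts pointwise on continuous functions. -/
def pointwiseApply (K : Type*) [TopologicalSpace K] [CompactSpace K]
    (E F : Type*) [NormedAddCommGroup E] [NormedSpace ℝ E] [NormedAddCommGroup F]
    [NormedSpace ℝ F] : C(K, E →L[ℝ] F) →L[ℝ] C(K, E) →L[ℝ] C(K, F) :=
  LinearMap.mkContinuous₂
    (LinearMap.mk₂ ℝ (fun (a : C(K, E →L[ℝ] F)) (h : C(K, E)) =>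
        (⟨fun t => a t (h t), by fun_prop⟩ : C(K, F)))
      (fun _ _ _ => by ext; simp) (fun _ _ _ => by ext; simp)
      (fun _ _ _ => by ext; simp) (fun _ _ _ => by ext; simp)) 1 (by
    intro a h
    rw [ContinuousMap.norm_le _ (by positivity)]
    intro t
    calc ‖a t (h t)‖ ≤ ‖a t‖ * ‖h t‖ := (a t).le_opNorm _
      _ ≤ ‖a‖ * ‖h‖ := by
        gcongr
        · exact a.norm_coe_le_norm t
        · exact h.norm_coe_le_norm t
      _ = 1 * ‖a‖ * ‖h‖ := by ring)

@[simp] theorem pointwiseApply_apply (a : C(K, E →L[ℝ] F)) (h : C(K, E)) (t : K) :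
    pointwiseApply K E F a h t = a t (h t) := rfl

/-- The superposition operator `γ ↦ f ∘ γ` of a `C¹` map is differentiable. -/
theorem hasFDerivAt_superposition (f : C(E, F)) (f' : C(E, E →L[ℝ] F))
    (hf : ∀ x, HasFDerivAt f (f' x) x) (γ : C(K, E)) :
    HasFDerivAt (fun γ : C(K, E) => f.comp γ) (pointwiseApply K E F (f'.comp γ)) γ := by
  rw [hasFDerivAt_iff_isLittleO_nhds_zero, Asymptotics.isLittleO_iff]
  intro ε hε
  have hc : Continuous fun γ : C(K, E) => f'.comp γ := ContinuousMap.continuous_postcomp f'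
  obtain ⟨δ, hδ, hball⟩ := (Metric.continuousAt_iff (α := C(K, E)) (β := C(K, E →L[ℝ] F))).1
    hc.continuousAt ε hε
  filter_upwards [Metric.ball_mem_nhds (0 : C(K, E)) hδ] with h hh
  rw [ContinuousMap.norm_le _ (by positivity)]
  intro t
  -- A point of the segment is the value at `t` of the curve `γ + s • h`, which is within `δ` of
  -- `γ`; continuity of `γ ↦ f' ∘ γ` in the sup norm therefore gives a bound independent of `t`.
  have hseg : ∀ x ∈ segment ℝ (γ t) (γ t + h t), ‖f' x - f' (γ t)‖ ≤ ε := by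
    intro x hx
    rw [segment_eq_image'] at hx
    obtain ⟨s, ⟨hs0, hs1⟩, rfl⟩ := hx
    have hs : dist (γ + s • h) γ < δ := by
      rw [dist_eq_norm, add_sub_cancel_left, norm_smul, Real.norm_of_nonneg hs0]
      have : ‖h‖ < δ := by simpa using hh
      nlinarith [norm_nonneg h]
    have := (ContinuousMap.norm_coe_le_norm (f'.comp (γ + s • h) - f'.comp γ) t).trans
      (dist_eq_norm (f'.comp (γ + s • h)) (f'.comp γ) ▸ (hball hs).le)
    simpa using this
  have := (convex_segment (𝕜 := ℝ) (γ t) (γ t + h t)).norm_image_sub_le_of_norm_hasFDerivWithin_le'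
    (fun x _ => (hf x).hasFDerivWithinAt) hseg (left_mem_segment ℝ _ _) (right_mem_segment ℝ _ _)
  simp only [add_sub_cancel_left] at this
  exact this.trans (by gcongr; exact h.norm_coe_le_norm t)

end Superposition

/-- The superposition operator of a smooth map is smooth. -/
theorem contDiff_superposition {K : Type*} [TopologicalSpace K] [CompactSpace K]
    {E F : Type u} [NormedAddCommGroup E] [NormedSpace ℝ E] [NormedAddCommGroup F]
    [NormedSpace ℝ F] (f : C(E, F)) (hf : ContDiff ℝ ∞ f) :
    ContDiff ℝ ∞ (fun γ : C(K, E) => f.comp γ) := by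
  rw [contDiff_infty]
  intro n
  induction n generalizing F with
  | zero => exact contDiff_zero.2 (ContinuousMap.continuous_postcomp f)
  | succ n ih =>
    obtain ⟨hd, hf'⟩ := contDiff_infty_iff_fderiv.1 hf
    -- The derivative of the operator of `f` is a bounded linear map after the operator of `f'`, so
    -- the induction passes from `F` to `E →L[ℝ] F`; this is why `E` and `F` share a universe.
    let f' : C(E, E →L[ℝ] F) := ⟨fderiv ℝ f, hf'.continuous⟩
    exact contDiff_succ_iff_hasFDerivAt.2 ⟨fun γ => pointwiseApply K E F (f'.comp γ),
      ContDiff.comp (g := pointwiseApply K E F) (ContinuousLinearMap.contDiff _) (ih f' hf'),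
      fun γ => hasFDerivAt_superposition f f' (fun x => (hd x).hasFDerivAt) γ⟩

/-! ### Integration as a bounded operator on curves. -/

section Primitive

open Set

variable {Y : Type*} [NormedAddCommGroup Y] [NormedSpace ℝ Y]

/-- The primitive vanishing at `0` of a continuous function on `[0, 1]`, extended to `ℝ`. -/
def primitive (γ : C(Icc (0 : ℝ) 1, Y)) (t : ℝ) : Y :=
  ∫ s in (0 : ℝ)..t, IccExtend zero_le_one γ s

theorem continuous_iccExtend {Y : Type*} [TopologicalSpace Y] (γ : C(Icc (0 : ℝ) 1, Y)) :
    Continuous (IccExtend zero_le_one γ) := γ.continuous.Icc_extend'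

/-- The constant extension of `γ` beyond `[0, 1]` is continuous, so the derivative is two-sided even
at the end points and one-sided derivatives can be avoided later. -/
theorem hasDerivAt_primitive [CompleteSpace Y] (γ : C(Icc (0 : ℝ) 1, Y)) (t : ℝ) :
    HasDerivAt (primitive γ) (IccExtend zero_le_one γ t) t :=
  intervalIntegral.integral_hasDerivAt_right ((continuous_iccExtend γ).intervalIntegrable _ _)
    ((continuous_iccExtend γ).stronglyMeasurableAtFilter _ _) (continuous_iccExtend γ).continuousAt

/-- Integration from `0` as a continuous linear operator on `C([0, 1], Y)`. -/
def primitiveCLM (Y : Type*) [NormedAddCommGroup Y] [NormedSpace ℝ Y] [CompleteSpace Y] :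
    C(Icc (0 : ℝ) 1, Y) →L[ℝ] C(Icc (0 : ℝ) 1, Y) :=
  LinearMap.mkContinuous
    { toFun := fun γ => ⟨fun t => primitive γ t,
        (continuous_iff_continuousAt.2 fun t => (hasDerivAt_primitive γ t).continuousAt).comp
          continuous_subtype_val⟩
      map_add' := fun γ δ => by
        ext t
        exact intervalIntegral.integral_add ((continuous_iccExtend γ).intervalIntegrable _ _)
          ((continuous_iccExtend δ).intervalIntegrable _ _)
      map_smul' := fun c γ => by
        ext t
        exact intervalIntegral.integral_smul c _ } 1 (by
    intro γ
    rw [ContinuousMap.norm_le _ (by positivity)]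
    intro t
    have := intervalIntegral.norm_integral_le_of_norm_le_const (a := 0) (b := (t : ℝ))
      (f := IccExtend zero_le_one γ) (C := ‖γ‖) fun s _ => γ.norm_coe_le_norm _
    have ht : |(t : ℝ) - 0| ≤ 1 := by
      rw [sub_zero, abs_of_nonneg t.2.1]
      exact t.2.2
    calc ‖primitive γ t‖ ≤ ‖γ‖ * |(t : ℝ) - 0| := this
      _ ≤ ‖γ‖ * 1 := by gcongr
      _ = 1 * ‖γ‖ := by ring)

@[simp] theorem primitiveCLM_apply [CompleteSpace Y] (γ : C(Icc (0 : ℝ) 1, Y))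
    (t : Icc (0 : ℝ) 1) : primitiveCLM Y γ t = primitive γ t := rfl

end Primitive

/-! ### Inverse functions. -/

/-- The inverse function theorem for smooth maps, with a smooth inverse on an open set. -/
theorem exists_smooth_local_inverse {E F : Type*} [NormedAddCommGroup E] [NormedSpace ℝ E]
    [CompleteSpace E] [NormedAddCommGroup F] [NormedSpace ℝ F] {f : E → F} {U : Set E} {a : E}
    (hU : IsOpen U) (ha : a ∈ U) (hf : ContDiffOn ℝ ∞ f U) {e : E ≃L[ℝ] F}
    (he : HasFDerivAt f (e : E →L[ℝ] F) a) :
    ∃ ψ : OpenPartialHomeomorph E F, a ∈ ψ.source ∧ ψ.source ⊆ U ∧ (ψ : E → F) = f ∧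
      ContDiffOn ℝ ∞ ψ.symm ψ.target ∧ ∀ x ∈ ψ.source, (fderiv ℝ f x).IsInvertible := by
  have hfa : ContDiffAt ℝ ∞ f a := hf.contDiffAt (hU.mem_nhds ha)
  have hn : (∞ : WithTop ℕ∞) ≠ 0 := by simp
  let ψ₀ := hfa.toOpenPartialHomeomorph f he hn
  have hcoe : (ψ₀ : E → F) = f := rfl
  -- Restricting to the open set where the derivative is invertible makes the inverse smooth on the
  -- whole target, not only at the image of `a`.
  have hO : IsOpen (U ∩ fderiv ℝ f ⁻¹' Set.range ((↑) : (E ≃L[ℝ] F) → E →L[ℝ] F)) :=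
    (hf.continuousOn_fderiv_of_isOpen hU (by simp)).isOpen_inter_preimage hU
      ContinuousLinearEquiv.isOpen
  let ψ := ψ₀.restrOpen _ hO
  have hsrc : ψ.source = ψ₀.source ∩
      (U ∩ fderiv ℝ f ⁻¹' Set.range ((↑) : (E ≃L[ℝ] F) → E →L[ℝ] F)) := rfl
  refine ⟨ψ, ?_, fun x hx => (hsrc ▸ hx).2.1, hcoe, ?_, fun x hx => (hsrc ▸ hx).2.2⟩
  · rw [hsrc]
    exact ⟨hfa.mem_toOpenPartialHomeomorph_source he hn, ha, e, he.fderiv.symm⟩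
  · intro y hy
    have hx := ψ.map_target hy
    obtain ⟨-, hxU, e', he'⟩ := hsrc ▸ hx
    have hfx : ContDiffAt ℝ ∞ f (ψ.symm y) := hf.contDiffAt (hU.mem_nhds hxU)
    refine (ψ.contDiffAt_symm hy (f₀' := e') ?_ hfx).contDiffWithinAt
    rw [he']
    exact (hfx.differentiableAt (by simp)).hasFDerivAt

/-! ### Total differential systems, solved along rays. -/

section Radial

open Set

variable {X Y : Type u} [NormedAddCommGroup X] [NormedSpace ℝ X]
  [NormedAddCommGroup Y] [NormedSpace ℝ Y]

/-- The curve `t ↦ ((x, t x), γ(t))` as a function of `((x, y), γ)`. -/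
def radialCurve (X Y : Type u) [NormedAddCommGroup X] [NormedSpace ℝ X]
    [NormedAddCommGroup Y] [NormedSpace ℝ Y] :
    (X × Y) × C(Icc (0 : ℝ) 1, Y) →L[ℝ] C(Icc (0 : ℝ) 1, (X × X) × Y) :=
  LinearMap.mkContinuous
    { toFun := fun p => ⟨fun t => ((p.1.1, (t : ℝ) • p.1.1), p.2 t), by fun_prop⟩
      map_add' := fun p q => by ext t <;> simp
      map_smul' := fun c p => by
        ext t
        · rfl
        · exact smul_comm (t : ℝ) c p.1.1
        · rfl } 1 (by
    intro p
    rw [ContinuousMap.norm_le _ (by positivity)]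
    intro t
    have h1 : ‖p.1.1‖ ≤ ‖p‖ := (norm_fst_le p.1).trans (norm_fst_le p)
    have h2 : ‖p.2 t‖ ≤ ‖p‖ := (p.2.norm_coe_le_norm t).trans (norm_snd_le p)
    have h3 : ‖(t : ℝ) • p.1.1‖ ≤ ‖p‖ := by
      rw [norm_smul, Real.norm_of_nonneg t.2.1]
      exact (mul_le_of_le_one_left (norm_nonneg _) t.2.2).trans h1
    rw [one_mul]
    exact max_le (max_le h1 h3) h2)

@[simp] theorem radialCurve_apply (p : (X × Y) × C(Icc (0 : ℝ) 1, Y)) (t : Icc (0 : ℝ) 1) :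
    radialCurve X Y p t = ((p.1.1, (t : ℝ) • p.1.1), p.2 t) := rfl

/-- The right-hand side `((x, ξ), y) ↦ A(ξ, y) x` of the radial equation. -/
def radialField (A : X × Y → X →L[ℝ] Y) (w : (X × X) × Y) : Y := A (w.1.2, w.2) w.1.1

theorem contDiff_radialField {A : X × Y → X →L[ℝ] Y} (hA : ContDiff ℝ ∞ A) :
    ContDiff ℝ ∞ (radialField A) := by
  unfold radialField
  exact (hA.comp (contDiff_fst.snd.prodMk contDiff_snd)).clm_apply contDiff_fst.fst

theorem hasFDerivAt_radialField {A : X × Y → X →L[ℝ] Y} (hA : ContDiff ℝ ∞ A)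
    (w : (X × X) × Y) : HasFDerivAt (radialField A) (fderiv ℝ (radialField A) w) w :=
  ((contDiff_radialField hA).differentiable (by simp) w).hasFDerivAt

/-- This formula is used twice: at the origin it makes the linearized integral equation trivial, and
along a solution it is the right-hand side of the variational equation. -/
theorem fderiv_radialField {A : X × Y → X →L[ℝ] Y} (hA : ContDiff ℝ ∞ A)
    (w v : (X × X) × Y) : fderiv ℝ (radialField A) w v =
      fderiv ℝ A (w.1.2, w.2) (v.1.2, v.2) w.1.1 + A (w.1.2, w.2) v.1.1 := by
  have h1 : HasFDerivAt A (fderiv ℝ A (w.1.2, w.2)) (w.1.2, w.2) :=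
    (hA.differentiable (by simp) _).hasFDerivAt
  have h2 : HasFDerivAt (fun w : (X × X) × Y => (w.1.2, w.2))
      (((ContinuousLinearMap.snd ℝ X X).comp (ContinuousLinearMap.fst ℝ (X × X) Y)).prod
        (ContinuousLinearMap.snd ℝ (X × X) Y)) w :=
    hasFDerivAt_fst.snd.prodMk hasFDerivAt_snd
  have h3 : HasFDerivAt (fun w : (X × X) × Y => w.1.1)
      ((ContinuousLinearMap.fst ℝ X X).comp (ContinuousLinearMap.fst ℝ (X × X) Y)) w :=
    hasFDerivAt_fst.fst
  have := ((h1.comp w h2).clm_apply h3).fderiv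
  change fderiv ℝ (radialField A) w = _ at this
  rw [this]
  simp [add_comm]

/-- Solutions of `γ' = A(t x, γ) x`, `γ(0) = y` on `[0, 1]`, depending smoothly on `(x, y)` near
`0`. -/
theorem exists_radial_solution [CompleteSpace X] [CompleteSpace Y] {A : X × Y → X →L[ℝ] Y}
    (hA : ContDiff ℝ ∞ A) :
    ∃ (Γ : X × Y → C(Icc (0 : ℝ) 1, Y)) (U : Set (X × Y)), IsOpen U ∧ (0 : X × Y) ∈ U ∧
      ContDiffOn ℝ ∞ Γ U ∧ Γ 0 = 0 ∧
      ∀ p ∈ U, Γ p = ContinuousLinearMap.const ℝ (Icc (0 : ℝ) 1) p.2 + primitiveCLM Y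
        ((⟨radialField A, (contDiff_radialField hA).continuous⟩ : C((X × X) × Y, Y)).comp
          (radialCurve X Y (p, Γ p))) := by
  set f : C((X × X) × Y, Y) := ⟨radialField A, (contDiff_radialField hA).continuous⟩ with hf
  set J := primitiveCLM Y
  set c := radialCurve X Y
  set k : Y →L[ℝ] C(Icc (0 : ℝ) 1, Y) := ContinuousLinearMap.const ℝ (Icc (0 : ℝ) 1)
  let f' : C((X × X) × Y, (X × X) × Y →L[ℝ] Y) :=
    ⟨fderiv ℝ (radialField A), ((contDiff_radialField hA).continuous_fderiv (by simp))⟩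
  -- The second component vanishes exactly on solutions of the integral equation. Carrying the
  -- parameter `p.1` along lets the inverse function theorem serve as an implicit function theorem.
  let G : (X × Y) × C(Icc (0 : ℝ) 1, Y) → (X × Y) × C(Icc (0 : ℝ) 1, Y) :=
    fun p => (p.1, p.2 - k p.1.2 - J (f.comp (c p)))
  have hN : ContDiff ℝ ∞ (fun γ : C(Icc (0 : ℝ) 1, (X × X) × Y) => f.comp γ) :=
    contDiff_superposition f (contDiff_radialField hA)
  have hG : ContDiff ℝ ∞ G := by
    refine contDiff_fst.prodMk ((contDiff_snd.sub (k.contDiff.comp contDiff_fst.snd)).sub ?_)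
    exact J.contDiff.comp (hN.comp c.contDiff)
  let D : (X × Y) × C(Icc (0 : ℝ) 1, Y) →L[ℝ] C(Icc (0 : ℝ) 1, Y) :=
    (J.comp (pointwiseApply _ _ _ (f'.comp 0))).comp c
  have hNc : HasFDerivAt (fun p => J (f.comp (c p))) D 0 := by
    have h1 : HasFDerivAt (fun γ : C(Icc (0 : ℝ) 1, (X × X) × Y) => f.comp γ)
        (pointwiseApply _ _ _ (f'.comp 0)) (c 0) := by
      rw [map_zero]
      exact hasFDerivAt_superposition f f' (hasFDerivAt_radialField hA) 0
    exact J.hasFDerivAt.comp 0 (h1.comp 0 c.hasFDerivAt)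
  -- The derivative of `G` at `0` is block triangular with identity diagonal: by `hD0` the integral
  -- term does not contribute to the `γ`-block.
  let e := (ContinuousLinearEquiv.refl ℝ (X × Y)).skewProd
    (ContinuousLinearEquiv.refl ℝ C(Icc (0 : ℝ) 1, Y))
    (-(k.comp (ContinuousLinearMap.snd ℝ X Y)) - D.comp (ContinuousLinearMap.inl ℝ _ _))
  -- The radial field is linear in `x`, so its derivative in the `y`-direction vanishes at `x = 0`.
  have hD0 : ∀ γ, D (0, γ) = 0 := by
    intro γ
    have : pointwiseApply (Icc (0 : ℝ) 1) _ _ (f'.comp 0) (c (0, γ)) = 0 := by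
      ext t
      simp [f', c, fderiv_radialField hA]
    simp only [D, ContinuousLinearMap.comp_apply, this, map_zero]
  have hGd : HasFDerivAt G (e : _ →L[ℝ] _) 0 := by
    have h := (hasFDerivAt_fst (𝕜 := ℝ) (p := (0 : (X × Y) × C(Icc (0 : ℝ) 1, Y)))).prodMk
      (((hasFDerivAt_snd (𝕜 := ℝ) (p := (0 : (X × Y) × C(Icc (0 : ℝ) 1, Y)))).sub
        (k.hasFDerivAt.comp 0 hasFDerivAt_fst.snd)).sub hNc)
    refine h.congr_fderiv (ContinuousLinearMap.ext fun v => ?_)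
    have hv : D v = D (v.1, 0) := by
      have : v = (v.1, 0) + (0, v.2) := by simp
      rw [this, map_add, hD0]
      simp
    refine Prod.ext rfl ?_
    change v.2 - k v.1.2 - D v = v.2 + (-(k v.1.2) - D (v.1, 0))
    rw [hv]
    abel
  obtain ⟨ψ, h0, -, hψ, hsymm, -⟩ := exists_smooth_local_inverse isOpen_univ (mem_univ 0)
    hG.contDiffOn hGd
  have hG0 : G 0 = 0 := by
    have : f.comp (c 0) = 0 := by
      ext t
      simp [hf, radialField, c]
    change ((0 : X × Y), (0 : C(Icc (0 : ℝ) 1, Y)) - k 0 - J (f.comp (c 0))) = 0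
    rw [this]
    simp
  have hι : Continuous fun p : X × Y => (p, (0 : C(Icc (0 : ℝ) 1, Y))) := by fun_prop
  refine ⟨fun p => (ψ.symm (p, 0)).2, (fun p => (p, 0)) ⁻¹' ψ.target,
    ψ.open_target.preimage hι, ?_, ?_, ?_, ?_⟩
  · have := ψ.map_source h0
    rwa [hψ, hG0] at this
  · exact contDiff_snd.comp_contDiffOn (hsymm.comp (contDiff_id.prodMk contDiff_const).contDiffOn
      fun p hp => hp)
  · have := ψ.left_inv h0
    rw [hψ, hG0] at this
    exact congrArg Prod.snd this
  · intro p hp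
    have := ψ.right_inv hp
    rw [hψ] at this
    have h1 : (ψ.symm (p, 0)).1 = p := congrArg Prod.fst this
    have h2 := congrArg Prod.snd this
    simp only [G] at h2
    have h3 : ψ.symm (p, 0) = (p, (ψ.symm (p, 0)).2) := Prod.ext h1 rfl
    rw [h3, sub_sub, sub_eq_zero] at h2
    exact h2

/-- If the total differential system `∂y/∂x = A(x, y)` satisfies the integrability condition near
`0`, then it has solutions `Φ(·, y)` with `Φ(0, y) = y`, depending smoothly on `y`. -/
theorem exists_total_solution [CompleteSpace X] [CompleteSpace Y] {A : X × Y → X →L[ℝ] Y}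
    (hA : ContDiff ℝ ∞ A) {W : Set (X × Y)} (hW : W ∈ 𝓝 0)
    (hfrob : ∀ z ∈ W, ∀ h k : X, fderiv ℝ A z (h, A z h) k = fderiv ℝ A z (k, A z k) h) :
    ∃ (Φ : X × Y → Y) (U : Set (X × Y)), IsOpen U ∧ (0 : X × Y) ∈ U ∧ ContDiffOn ℝ ∞ Φ U ∧
      (∀ y, (0, y) ∈ U → Φ (0, y) = y) ∧ (∀ p ∈ U, (p.1, Φ p) ∈ W) ∧
      ∀ p ∈ U, ∀ h, fderiv ℝ Φ p (h, 0) = A (p.1, Φ p) h := by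
  obtain ⟨Γ, U₀, hU₀, h0, hΓ, hΓ0, heq⟩ := exists_radial_solution hA
  set f : C((X × X) × Y, Y) := ⟨radialField A, (contDiff_radialField hA).continuous⟩ with hf
  let f' : C((X × X) × Y, (X × X) × Y →L[ℝ] Y) :=
    ⟨fderiv ℝ (radialField A), ((contDiff_radialField hA).continuous_fderiv (by simp))⟩
  set c := radialCurve X Y
  obtain ⟨ε, hε, hball⟩ := Metric.mem_nhds_iff.1 hW
  have hcont : ContinuousOn (fun p => c (p, Γ p)) U₀ :=
    c.continuous.comp_continuousOn (continuousOn_id.prodMk hΓ.continuousOn)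
  -- The sup norm controls the whole curve `(t x, γ(t))`, which thus stays in `W`; integrability is
  -- needed at every time, not only at `t = 1`.
  let U : Set (X × Y) := U₀ ∩ (fun p => c (p, Γ p)) ⁻¹' Metric.ball 0 ε
  have hU : IsOpen U := hcont.isOpen_inter_preimage hU₀ Metric.isOpen_ball
  have hmemW : ∀ p ∈ U, ∀ t : Icc (0 : ℝ) 1, ((t : ℝ) • p.1, Γ p t) ∈ W := by
    intro p hp t
    apply hball
    have h1 : ‖c (p, Γ p)‖ < ε := by simpa using hp.2
    have h2 := (c (p, Γ p)).norm_coe_le_norm t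
    rw [mem_ball_zero_iff]
    refine lt_of_le_of_lt ?_ h1
    refine le_trans ?_ h2
    exact max_le ((norm_snd_le _).trans (norm_fst_le (c (p, Γ p) t))) (norm_snd_le (c (p, Γ p) t))
  let one : Icc (0 : ℝ) 1 := ⟨1, zero_le_one, le_rfl⟩
  let ev : C(Icc (0 : ℝ) 1, Y) →L[ℝ] Y := ContinuousMap.evalCLM ℝ one
  refine ⟨fun p => Γ p one, U, hU, ⟨h0, ?_⟩, ev.contDiff.comp_contDiffOn
    (hΓ.mono inter_subset_left), ?_, ?_, ?_⟩
  · change c (0, Γ 0) ∈ Metric.ball 0 ε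
    rw [hΓ0]
    have : ((0 : X × Y), (0 : C(Icc (0 : ℝ) 1, Y))) = 0 := rfl
    rw [this, map_zero]
    exact Metric.mem_ball_self hε
  · intro y hy
    have h1 : f.comp (c ((0, y), Γ (0, y))) = 0 := by
      ext t
      simp [hf, radialField, c]
    have := heq _ hy.1
    rw [h1, map_zero, add_zero] at this
    simp [this]
  · intro p hp
    simpa [one] using hmemW p hp one
  intro p hp h
  have hΓd : HasFDerivAt Γ (fderiv ℝ Γ p) p :=
    ((hΓ.contDiffAt (hU₀.mem_nhds hp.1)).differentiableAt (by simp)).hasFDerivAt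
  set Γ' := fderiv ℝ Γ p (h, 0) with hΓ'
  have hΦ' : fderiv ℝ (fun p => Γ p one) p (h, 0) = Γ' one := by
    have : HasFDerivAt (fun p => Γ p one) (ev.comp (fderiv ℝ Γ p)) p :=
      ev.hasFDerivAt.comp p hΓd
    rw [this.fderiv]
    rfl
  rw [hΦ']
  -- the linearized integral equation
  set g : C(Icc (0 : ℝ) 1, Y) :=
    pointwiseApply _ _ _ (f'.comp (c (p, Γ p))) (c ((h, 0), Γ')) with hg
  have hlin : Γ' = primitiveCLM Y g := by
    have h1 : HasFDerivAt (fun q => c (q, Γ q))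
        (c.comp ((ContinuousLinearMap.id ℝ _).prod (fderiv ℝ Γ p))) p :=
      c.hasFDerivAt.comp p ((hasFDerivAt_id p).prodMk hΓd)
    have h2 := (hasFDerivAt_superposition f f' (hasFDerivAt_radialField hA) (c (p, Γ p))).comp p h1
    have h3 := ((ContinuousLinearMap.const ℝ (Icc (0 : ℝ) 1)).hasFDerivAt.comp p
      (hasFDerivAt_snd (𝕜 := ℝ) (E := X) (F := Y) (p := p))).add
      ((primitiveCLM Y).hasFDerivAt.comp p h2)
    -- Both sides of the integral equation agree near `p`, so their derivatives agree.
    have h4 := (h3.congr_of_eventuallyEq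
      (Filter.eventually_of_mem (hU₀.mem_nhds hp.1) heq)).unique hΓd
    have h5 := DFunLike.congr_fun h4 (h, 0)
    rw [hΓ', ← h5]
    have : ContinuousLinearMap.const ℝ (Icc (0 : ℝ) 1) (0 : Y) = 0 := map_zero _
    simp [this, hg, hΓ']
  set γ : C(Icc (0 : ℝ) 1, Y) := f.comp (c (p, Γ p)) with hγ
  have hproj : ∀ t (ht : t ∈ Icc (0 : ℝ) 1) (δ : C(Icc (0 : ℝ) 1, Y)),
      IccExtend zero_le_one δ t = δ ⟨t, ht⟩ := fun t ht δ => IccExtend_of_mem _ _ ht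
  let z : ℝ → Y := primitive g
  let y : ℝ → Y := fun t => p.2 + primitive γ t
  have hz : ∀ t (ht : t ∈ Icc (0 : ℝ) 1), Γ' ⟨t, ht⟩ = z t := fun t ht =>
    DFunLike.congr_fun hlin ⟨t, ht⟩
  have hy : ∀ t (ht : t ∈ Icc (0 : ℝ) 1), Γ p ⟨t, ht⟩ = y t := fun t ht =>
    DFunLike.congr_fun (heq p hp.1) ⟨t, ht⟩
  have hy' : ∀ t ∈ Icc (0 : ℝ) 1, HasDerivAt y (A (t • p.1, y t) p.1) t := by
    intro t ht
    have := (hasDerivAt_primitive γ t).const_add p.2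
    rw [hproj t ht] at this
    rw [← hy t ht]
    exact this
  have hz' : ∀ t ∈ Icc (0 : ℝ) 1, HasDerivAt z
      (fderiv ℝ A (t • p.1, y t) (t • h, z t) p.1 + A (t • p.1, y t) h) t := by
    intro t ht
    have := hasDerivAt_primitive g t
    rw [hproj t ht] at this
    rw [← hy t ht, ← hz t ht]
    have h1 : g ⟨t, ht⟩ = _ := fderiv_radialField hA (c (p, Γ p) ⟨t, ht⟩) (c ((h, 0), Γ') ⟨t, ht⟩)
    rw [h1] at this
    exact this
  -- The defect between the variation `z` of the solution in direction `h` and its expected value;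
  -- since `γ(t)` should be `Φ(t x, y)`, the chain rule predicts the factor `t`.
  let w : ℝ → Y := fun t => z t - t • A (t • p.1, y t) h
  have hw' : ∀ t ∈ Icc (0 : ℝ) 1,
      HasDerivAt w (fderiv ℝ A (t • p.1, y t) (0, w t) p.1) t := by
    intro t ht
    have hmem : (t • p.1, y t) ∈ W := by
      rw [← hy t ht]
      exact hmemW p hp ⟨t, ht⟩
    have h1 : HasDerivAt (fun t : ℝ => (t • p.1, y t)) (p.1, A (t • p.1, y t) p.1) t := by
      have := (hasDerivAt_id t).smul_const p.1
      rw [one_smul] at this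
      exact this.prodMk (hy' t ht)
    have h2 := ((hA.differentiable (by simp) (t • p.1, y t)).hasFDerivAt.comp_hasDerivAt t h1)
    have h3 := ((hasDerivAt_id t).smul (h2.clm_apply (hasDerivAt_const t h)))
    refine ((hz' t ht).sub h3).congr_deriv ?_
    -- After this splitting, `hfrob` exchanges `h` and `p.1` in the first summand, which then
    -- cancels against the product rule for `t • A (t x, y) h`; only the part linear in `w`
    -- survives.
    have h4 : (t • h, z t) = t • (h, A (t • p.1, y t) h) + (0, w t) := by
      simp [w]
    rw [h4, map_add, map_smul, add_apply, smul_apply, hfrob _ hmem]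
    simp
  have hwc : ContinuousOn w (Icc 0 1) := fun t ht => (hw' t ht).continuousAt.continuousWithinAt
  have hyc : ContinuousOn y (Icc 0 1) := fun t ht => (hy' t ht).continuousAt.continuousWithinAt
  have hbound : ContinuousOn (fun t : ℝ => fderiv ℝ A (t • p.1, y t)) (Icc 0 1) :=
    (hA.continuous_fderiv (by simp)).comp_continuousOn
      ((continuous_id.smul continuous_const).continuousOn.prodMk hyc)
  obtain ⟨C, hC⟩ := isCompact_Icc.exists_bound_of_continuousOn
    (E := X × Y →L[ℝ] X →L[ℝ] Y) hbound
  have hw0 : w 0 = 0 := by simp [w, z, primitive]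
  -- Grönwall: `w` has zero initial value and satisfies a linear equation whose coefficients are
  -- bounded on the compact interval.
  have hw1 := eq_zero_of_abs_deriv_le_mul_abs_self_of_eq_zero_right (K := C * ‖p.1‖) hwc
    (fun t ht => (hw' t (Ico_subset_Icc_self ht)).hasDerivWithinAt) hw0 (fun t ht => by
      have h1 := hC t (Ico_subset_Icc_self ht)
      calc ‖fderiv ℝ A (t • p.1, y t) (0, w t) p.1‖
          ≤ ‖fderiv ℝ A (t • p.1, y t) (0, w t)‖ * ‖p.1‖ := ContinuousLinearMap.le_opNorm _ _
        _ ≤ (C * ‖w t‖) * ‖p.1‖ := by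
            gcongr
            refine (ContinuousLinearMap.le_opNorm _ _).trans ?_
            have : ‖((0 : X), w t)‖ = ‖w t‖ := by simp [Prod.norm_def]
            rw [this]
            gcongr
        _ = C * ‖p.1‖ * ‖w t‖ := by ring) 1 ⟨zero_le_one, le_rfl⟩
  simp only [w, one_smul, sub_eq_zero] at hw1
  exact (hz 1 one.2).trans (hw1.trans (by rw [← hy 1 one.2]))

end Radial

/-! ### The Frobenius theorem. -/

/-- A distribution given as the graph of a map `A` that satisfies the integrability condition near
`0` is flattened by a local diffeomorphism. -/
theorem exists_flattening_of_graph {X Y : Type u} [NormedAddCommGroup X] [NormedSpace ℝ X]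
    [NormedAddCommGroup Y] [NormedSpace ℝ Y] [CompleteSpace X] [CompleteSpace Y]
    {A : X × Y → X →L[ℝ] Y}
    (hA : ContDiff ℝ ∞ A) {W : Set (X × Y)} (hW : W ∈ 𝓝 0)
    (hfrob : ∀ z ∈ W, ∀ h k : X, fderiv ℝ A z (h, A z h) k = fderiv ℝ A z (k, A z k) h) :
    ∃ ψ : OpenPartialHomeomorph (Y × X) (Y × X), (0 : Y × X) ∈ ψ.source ∧
      (∀ z ∈ ψ.source, z.swap ∈ W) ∧ ContDiffOn ℝ ∞ ψ ψ.source ∧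
      ContDiffOn ℝ ∞ ψ.symm ψ.target ∧
      ∀ z ∈ ψ.source, ∀ v, v.1 = A z.swap v.2 ↔ (fderiv ℝ ψ z v).1 = 0 := by
  obtain ⟨Φ, U, hU, h0, hΦ, hΦ0, hΦW, hΦA⟩ := exists_total_solution hA hW hfrob
  let S : (Y × X) ≃L[ℝ] (X × Y) := ContinuousLinearEquiv.prodComm ℝ Y X
  -- `Ψ` carries each slice of constant first coordinate to the solution graph with that initial
  -- value; the straightening chart is its local inverse.
  let Ψ : Y × X → Y × X := fun w => (Φ (S w), w.2)
  let U' : Set (Y × X) := S ⁻¹' U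
  have hU' : IsOpen U' := hU.preimage S.continuous
  have hΨ : ContDiffOn ℝ ∞ Ψ U' :=
    (hΦ.comp S.contDiff.contDiffOn fun w hw => hw).prodMk contDiff_snd.contDiffOn
  have hΦd : ∀ p ∈ U, HasFDerivAt Φ (fderiv ℝ Φ p) p := fun p hp =>
    ((hΦ.contDiffAt (hU.mem_nhds hp)).differentiableAt (by simp)).hasFDerivAt
  have hΨd : ∀ w ∈ U', HasFDerivAt Ψ (((fderiv ℝ Φ (S w)).comp (S : _ →L[ℝ] _)).prod
      (ContinuousLinearMap.snd ℝ Y X)) w := fun w hw =>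
    ((hΦd _ hw).comp w S.hasFDerivAt).prodMk hasFDerivAt_snd
  have hΨv : ∀ w ∈ U', ∀ u, fderiv ℝ Ψ w u =
      (fderiv ℝ Φ (S w) (0, u.1) + A (w.2, Φ (S w)) u.2, u.2) := by
    intro w hw u
    rw [(hΨd w hw).fderiv]
    refine Prod.ext ?_ rfl
    change fderiv ℝ Φ (S w) (u.2, u.1) = _
    have : (u.2, u.1) = ((0 : X), u.1) + (u.2, (0 : Y)) := by simp
    rw [this, map_add, hΦA _ hw]
    rfl
  have h00 : fderiv ℝ Φ (S 0) = (A 0).coprod (ContinuousLinearMap.id ℝ Y) := by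
    have e0 : (S 0 : X × Y) = 0 := rfl
    rw [e0]
    have hΦ00 : Φ 0 = 0 := hΦ0 0 h0
    have h1 : ∀ v : Y, fderiv ℝ Φ 0 (0, v) = v := by
      intro v
      have h2 : HasFDerivAt (fun y : Y => Φ (0, y)) ((fderiv ℝ Φ 0).comp
          (ContinuousLinearMap.inr ℝ X Y)) 0 :=
        HasFDerivAt.comp (g := Φ) (f := fun y : Y => ((0 : X), y)) 0 (hΦd 0 h0)
          (hasFDerivAt_prodMk_right (0 : X) (0 : Y))
      have hopen : IsOpen {y : Y | ((0 : X), y) ∈ U} := hU.preimage (by fun_prop)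
      have h3 : HasFDerivAt (fun y : Y => Φ (0, y)) (ContinuousLinearMap.id ℝ Y) 0 :=
        (hasFDerivAt_id (0 : Y)).congr_of_eventuallyEq
          (Filter.eventually_of_mem (hopen.mem_nhds h0) fun y hy => hΦ0 y hy)
      exact DFunLike.congr_fun (h2.unique h3) v
    refine ContinuousLinearMap.ext fun p => ?_
    have h4 : p = (p.1, (0 : Y)) + ((0 : X), p.2) := by simp
    have h5 := hΦA 0 h0 p.1
    rw [hΦ00] at h5
    rw [h4, map_add, h1, h5]
    simp
    rfl
  let e : (Y × X) ≃L[ℝ] (Y × X) := (S.trans ((ContinuousLinearEquiv.refl ℝ X).skewProd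
    (ContinuousLinearEquiv.refl ℝ Y) (A 0))).trans S.symm
  -- At the origin `∂Φ/∂y` is the identity and `∂Φ/∂x = A 0`, so `dΨ` is a shear.
  have he : HasFDerivAt Ψ (e : _ →L[ℝ] _) 0 := by
    refine (hΨd 0 h0).congr_fderiv (ContinuousLinearMap.ext fun v => ?_)
    rw [h00]
    refine Prod.ext ?_ rfl
    change A 0 v.2 + v.1 = v.1 + A 0 v.2
    exact add_comm _ _
  obtain ⟨ψ, hψ0, hψU, hψ, hsymm, hinv⟩ := exists_smooth_local_inverse hU' h0 hΨ he
  have hΨ0 : Ψ 0 = 0 := Prod.ext (hΦ0 0 h0) rfl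
  refine ⟨ψ.symm, ?_, ?_, hsymm, ?_, ?_⟩
  · have := ψ.map_source hψ0
    rwa [hψ, hΨ0] at this
  · intro z hz
    have hw := hψU (ψ.map_target hz)
    have h1 := ψ.right_inv hz
    rw [hψ] at h1
    have h2 := hΦW _ hw
    rw [← h1]
    exact h2
  · rw [ψ.symm_symm, hψ]
    exact hΨ.mono hψU
  · intro z hz v
    set w := ψ.symm z with hw
    have hws : w ∈ ψ.source := ψ.map_target hz
    have hz1 : Ψ w = z := by
      have h1 := ψ.right_inv hz
      rwa [hψ] at h1
    have hzs : z.swap = (w.2, Φ (S w)) := by rw [← hz1]; rfl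
    set u := fderiv ℝ ψ.symm z v with hu
    have hv : v = fderiv ℝ Ψ w u := by
      have hd : HasFDerivAt ψ.symm (fderiv ℝ ψ.symm z) z :=
        ((hsymm.contDiffAt (ψ.open_target.mem_nhds hz)).differentiableAt (by simp)).hasFDerivAt
      have hd2 : HasFDerivAt Ψ (fderiv ℝ Ψ w) w :=
        ((hΨ.contDiffAt (hU'.mem_nhds (hψU hws))).differentiableAt (by simp)).hasFDerivAt
      have h3 := (hd2.comp z hd).congr_of_eventuallyEq (f₁ := id)
        (Filter.eventually_of_mem (ψ.open_target.mem_nhds hz) fun y hy => by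
          have h1 := ψ.right_inv hy
          rw [hψ] at h1
          exact h1.symm)
      exact DFunLike.congr_fun ((hasFDerivAt_id z).unique h3) v
    rw [hΨv w (hψU hws)] at hv
    have hv1 : v.1 = fderiv ℝ Φ (S w) (0, u.1) + A z.swap u.2 := by
      rw [hzs]
      exact (Prod.ext_iff.1 hv).1
    have hv2 : v.2 = u.2 := (Prod.ext_iff.1 hv).2
    rw [hv1, hv2, add_eq_right]
    constructor
    · intro h
      -- `dΨ` sends `(u.1, 0)` to `(∂Φ/∂y · u.1, 0) = 0`, so injectivity of `dΨ` gives `u.1 = 0`.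
      obtain ⟨e', he'⟩ := hinv w hws
      have h5 : e' (u.1, 0) = 0 := by
        have := hΨv w (hψU hws) (u.1, 0)
        rw [← he'] at this
        refine this.trans ?_
        rw [h]
        simp
      exact congrArg Prod.fst (e'.map_eq_zero_iff.1 h5)
    · intro h
      rw [h]
      exact map_zero _

/-- A map that is smooth near a point of a finite-dimensional space agrees near that point with a
globally smooth map. -/
theorem exists_contDiff_eventuallyEq {E F : Type*} [NormedAddCommGroup E] [NormedSpace ℝ E]
    [FiniteDimensional ℝ E] [NormedAddCommGroup F] [NormedSpace ℝ F] {f : E → F} {O : Set E}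
    {a : E} (hO : IsOpen O) (ha : a ∈ O) (hf : ContDiffOn ℝ ∞ f O) :
    ∃ g : E → F, ContDiff ℝ ∞ g ∧ g =ᶠ[𝓝 a] f := by
  obtain ⟨ε, hε, hball⟩ := Metric.isOpen_iff.1 hO a ha
  let χ : ContDiffBump a := ⟨ε / 4, ε / 2, by positivity, by linarith⟩
  refine ⟨fun x => χ x • f x, contDiff_iff_contDiffAt.2 fun x => ?_, ?_⟩
  · by_cases hx : x ∈ O
    · exact χ.contDiffAt.smul (hf.contDiffAt (hO.mem_nhds hx))
    · have hxt : x ∈ (tsupport χ)ᶜ := by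
        rw [χ.tsupport_eq]
        intro hx'
        exact hx (hball (Metric.closedBall_subset_ball (by change ε / 2 < ε; linarith) hx'))
      refine (contDiffAt_const (c := (0 : F))).congr_of_eventuallyEq ?_
      filter_upwards [(isClosed_tsupport _).isOpen_compl.mem_nhds hxt] with y hy
      rw [image_eq_zero_of_notMem_tsupport hy, zero_smul]
  · filter_upwards [χ.eventuallyEq_one] with x hx
    rw [hx, Pi.one_apply, one_smul]

/-- Linear coordinates in which a linear map of rank `q` has the kernel `0 × ℝᵐ`. -/
theorem exists_adapted_equiv {V F : Type*} [NormedAddCommGroup V] [NormedSpace ℝ V]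
    [FiniteDimensional ℝ V] [NormedAddCommGroup F] [NormedSpace ℝ F] [FiniteDimensional ℝ F]
    (T : V →L[ℝ] F) {q m : ℕ} (hq : Module.finrank ℝ (LinearMap.range (T : V →ₗ[ℝ] F)) = q)
    (hm : q + m = Module.finrank ℝ V) :
    ∃ (L : V ≃L[ℝ] EuclideanSpace ℝ (Fin q) × EuclideanSpace ℝ (Fin m))
      (P : F →L[ℝ] EuclideanSpace ℝ (Fin q)), ∀ v, P (T v) = (L v).1 := by
  let R := LinearMap.range (T : V →ₗ[ℝ] F)
  let N := LinearMap.ker (T : V →ₗ[ℝ] F)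
  have hN : Module.finrank ℝ N = m := by
    have : Module.finrank ℝ R + Module.finrank ℝ N = Module.finrank ℝ V :=
      LinearMap.finrank_range_add_finrank_ker (T : V →ₗ[ℝ] F)
    have : Module.finrank ℝ R = q := hq
    omega
  let eR : R ≃ₗ[ℝ] EuclideanSpace ℝ (Fin q) :=
    LinearEquiv.ofFinrankEq _ _ (hq.trans finrank_euclideanSpace_fin.symm)
  let eN : N ≃ₗ[ℝ] EuclideanSpace ℝ (Fin m) :=
    LinearEquiv.ofFinrankEq _ _ (hN.trans finrank_euclideanSpace_fin.symm)
  -- `P` reads off coordinates on the range of `T` and `C` on its kernel, so `v ↦ (P (T v), C v)` is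
  -- injective between spaces of equal dimension.
  obtain ⟨P, hP⟩ := LinearMap.exists_extend eR.toLinearMap
  obtain ⟨C, hC⟩ := LinearMap.exists_extend eN.toLinearMap
  let L₀ : V →ₗ[ℝ] EuclideanSpace ℝ (Fin q) × EuclideanSpace ℝ (Fin m) :=
    (P.comp (T : V →ₗ[ℝ] F)).prod C
  have hPR : ∀ v, P (T v) = eR ⟨T v, v, rfl⟩ := fun v => LinearMap.congr_fun hP ⟨T v, v, rfl⟩
  have hinj : Function.Injective L₀ := by
    rw [← LinearMap.ker_eq_bot, LinearMap.ker_eq_bot']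
    intro v hv
    have h1 : P (T v) = 0 := congrArg Prod.fst hv
    have h2 : C v = 0 := congrArg Prod.snd hv
    rw [hPR, LinearEquiv.map_eq_zero_iff] at h1
    have hvN : v ∈ N := congrArg Subtype.val h1
    have h3 : C v = eN ⟨v, hvN⟩ := LinearMap.congr_fun hC ⟨v, hvN⟩
    rw [h3, LinearEquiv.map_eq_zero_iff] at h2
    exact congrArg Subtype.val h2
  let L := L₀.linearEquivOfInjective hinj (by simp [hm])
  exact ⟨L.toContinuousLinearEquiv, LinearMap.toContinuousLinearMap P, fun v => rfl⟩

/-- **Frobenius theorem**, local version for the kernel of a smooth family of linear maps of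
constant rank: it is flattened by a local diffeomorphism if it is closed under Lie brackets. -/
theorem exists_flattening {V F : Type*} [NormedAddCommGroup V] [NormedSpace ℝ V]
    [FiniteDimensional ℝ V] [NormedAddCommGroup F] [NormedSpace ℝ F] [FiniteDimensional ℝ F]
    {E : V → V →L[ℝ] F} {U : Set V} {z₀ : V} (hU : IsOpen U) (hz₀ : z₀ ∈ U)
    (hE : ContDiffOn ℝ ∞ E U) {q m : ℕ}
    (hq : ∀ z ∈ U, Module.finrank ℝ (LinearMap.range (E z : V →ₗ[ℝ] F)) = q)
    (hm : q + m = Module.finrank ℝ V)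
    (hinv : ∀ O : Set V, IsOpen O → O ⊆ U → ∀ Z₁ Z₂ : V → V, ContDiffOn ℝ ∞ Z₁ O →
      ContDiffOn ℝ ∞ Z₂ O → (∀ z ∈ O, E z (Z₁ z) = 0) → (∀ z ∈ O, E z (Z₂ z) = 0) →
      ∀ z ∈ O, E z (VectorField.lieBracket ℝ Z₁ Z₂ z) = 0) :
    ∃ ψ : OpenPartialHomeomorph V (EuclideanSpace ℝ (Fin q) × EuclideanSpace ℝ (Fin m)),
      z₀ ∈ ψ.source ∧ ψ.source ⊆ U ∧ ContDiffOn ℝ ∞ ψ ψ.source ∧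
      ContDiffOn ℝ ∞ ψ.symm ψ.target ∧
      ∀ z ∈ ψ.source, ∀ v, E z v = 0 ↔ (fderiv ℝ ψ z v).1 = 0 := by
  obtain ⟨L, P, hLP⟩ := exists_adapted_equiv (E z₀) (hq z₀ hz₀) hm
  let Y := EuclideanSpace ℝ (Fin q)
  let X := EuclideanSpace ℝ (Fin m)
  let B : V → Y × X →L[ℝ] Y := fun z => (P.comp (E z)).comp (L.symm : Y × X →L[ℝ] V)
  have hB : ContDiffOn ℝ ∞ B U := (contDiffOn_const.clm_comp hE).clm_comp contDiffOn_const
  let B₁ : V → Y →L[ℝ] Y := fun z => (B z).comp (ContinuousLinearMap.inl ℝ Y X)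
  let B₂ : V → X →L[ℝ] Y := fun z => (B z).comp (ContinuousLinearMap.inr ℝ Y X)
  have hB₁ : ContDiffOn ℝ ∞ B₁ U := hB.clm_comp contDiffOn_const
  have hB₂ : ContDiffOn ℝ ∞ B₂ U := hB.clm_comp contDiffOn_const
  let U₁ := U ∩ B₁ ⁻¹' Set.range ((↑) : (Y ≃L[ℝ] Y) → Y →L[ℝ] Y)
  have hU₁ : IsOpen U₁ := hB₁.continuousOn.isOpen_inter_preimage hU ContinuousLinearEquiv.isOpen
  have hz₁ : z₀ ∈ U₁ := by
    refine ⟨hz₀, ContinuousLinearEquiv.refl ℝ Y, ContinuousLinearMap.ext fun y => ?_⟩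
    change y = P (E z₀ (L.symm (y, 0)))
    rw [hLP, L.apply_symm_apply]
  -- `B₁ z₀` is the identity, so `B₁` is invertible nearby and `B₁ y + B₂ x = 0` can be solved for
  -- `y`.
  let A₀ : V → X →L[ℝ] Y := fun z => -((B₁ z).inverse.comp (B₂ z))
  have hA₀ : ContDiffOn ℝ ∞ A₀ U₁ := by
    refine (ContDiffOn.clm_comp (fun z hz => ?_) (hB₂.mono Set.inter_subset_left)).neg
    obtain ⟨e, he⟩ := hz.2
    have h1 : ContDiffAt ℝ ∞ ContinuousLinearMap.inverse (B₁ z) := he ▸ contDiffAt_map_inverse e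
    exact h1.comp_contDiffWithinAt z (hB₁.mono Set.inter_subset_left z hz)
  have hker : ∀ z ∈ U₁, ∀ v, E z v = 0 ↔ (L v).1 = A₀ z (L v).2 := by
    intro z hz
    obtain ⟨e, he⟩ := hz.2
    let S : Submodule ℝ V := LinearMap.ker ((((ContinuousLinearMap.fst ℝ Y X) -
      (A₀ z).comp (ContinuousLinearMap.snd ℝ Y X)).comp (L : V →L[ℝ] Y × X) : V →L[ℝ] Y) :
        V →ₗ[ℝ] Y)
    have hS : ∀ v, v ∈ S ↔ (L v).1 = A₀ z (L v).2 := fun v => sub_eq_zero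
    have hle : LinearMap.ker (E z : V →ₗ[ℝ] F) ≤ S := by
      intro v hv
      have hv : E z v = 0 := hv
      rw [hS]
      have h1 : B z (L v) = 0 := by
        change P (E z (L.symm (L v))) = 0
        rw [L.symm_apply_apply, hv, map_zero]
      have h2 : B₁ z (L v).1 + B₂ z (L v).2 = 0 := by
        rw [← h1]
        change B z ((L v).1, 0) + B z (0, (L v).2) = B z (L v)
        rw [← map_add]
        simp
      rw [← he] at h2
      change (L v).1 = -((B₁ z).inverse (B₂ z (L v).2))
      rw [← he, ContinuousLinearMap.inverse_equiv, eq_neg_of_add_eq_zero_right h2]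
      simp only [map_neg, ContinuousLinearEquiv.coe_coe, ContinuousLinearEquiv.symm_apply_apply]
      exact (neg_neg _).symm
    -- Constant rank enters here: composing with `P` could enlarge the kernel, but the graph and
    -- `ker E` both have dimension `m`.
    have hfin : Module.finrank ℝ S ≤ Module.finrank ℝ (LinearMap.ker (E z : V →ₗ[ℝ] F)) := by
      have h1 := LinearMap.finrank_range_add_finrank_ker (E z : V →ₗ[ℝ] F)
      rw [hq z hz.1] at h1
      have h2 : Module.finrank ℝ S ≤ Module.finrank ℝ X := by
        refine LinearMap.finrank_le_finrank_of_injective (f := ((LinearMap.snd ℝ Y X).comp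
          (L : V →ₗ[ℝ] Y × X)).comp S.subtype) ?_
        rw [← LinearMap.ker_eq_bot, LinearMap.ker_eq_bot']
        rintro ⟨v, hv⟩ hv2
        have hv2 : (L v).2 = 0 := hv2
        have hv1 : (L v).1 = 0 := by rw [(hS v).1 hv, hv2, map_zero]
        exact Subtype.ext (L.map_eq_zero_iff.1 (Prod.ext hv1 hv2))
      have h3 : Module.finrank ℝ X = m := by simp [X]
      omega
    have heq := Submodule.eq_of_le_of_finrank_le hle hfin
    intro v
    rw [← hS, ← heq]
    rfl
  -- integrability condition
  let Z : X → V → V := fun h z => L.symm (A₀ z h, h)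
  have hZ : ∀ h, ContDiffOn ℝ ∞ (Z h) U₁ := fun h =>
    L.symm.contDiff.comp_contDiffOn ((hA₀.clm_apply contDiffOn_const).prodMk contDiffOn_const)
  have hZker : ∀ h, ∀ z ∈ U₁, E z (Z h z) = 0 := by
    intro h z hz
    rw [hker z hz]
    simp [Z]
  have hA₀d : ∀ z ∈ U₁, HasFDerivAt A₀ (fderiv ℝ A₀ z) z := fun z hz =>
    ((hA₀.contDiffAt (hU₁.mem_nhds hz)).differentiableAt (by simp)).hasFDerivAt
  have hZd : ∀ h, ∀ z ∈ U₁, ∀ v, fderiv ℝ (Z h) z v = L.symm (fderiv ℝ A₀ z v h, 0) := by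
    intro h z hz v
    have h1 := L.symm.hasFDerivAt.comp z
      (((hA₀d z hz).clm_apply (hasFDerivAt_const h z)).prodMk (hasFDerivAt_const h z))
    change HasFDerivAt (Z h) _ z at h1
    rw [h1.fderiv]
    simp
  have hfrob₀ : ∀ z ∈ U₁, ∀ h k, fderiv ℝ A₀ z (Z h z) k = fderiv ℝ A₀ z (Z k z) h := by
    intro z hz h k
    -- The `X`-components of these fields are constant, so their bracket has zero `X`-component;
    -- lying in the graph, it vanishes altogether, which is the integrability condition.
    have h1 := hinv U₁ hU₁ Set.inter_subset_left (Z h) (Z k) (hZ h) (hZ k) (hZker h) (hZker k) z hz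
    rw [hker z hz, VectorField.lieBracket, hZd k z hz, hZd h z hz, ← map_sub] at h1
    simpa [sub_eq_zero] using h1
  -- passing to coordinates centred at `z₀`
  let T : (X × Y) ≃L[ℝ] V := (ContinuousLinearEquiv.prodComm ℝ X Y).trans L.symm
  let aff : X × Y → V := fun w => z₀ + T w
  have haffd : ∀ w, HasFDerivAt aff (T : X × Y →L[ℝ] V) w := fun w => T.hasFDerivAt.const_add z₀
  have haff : ContDiff ℝ ∞ aff := contDiff_const.add T.contDiff
  have hO : IsOpen (aff ⁻¹' U₁) := hU₁.preimage haff.continuous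
  have hO0 : (0 : X × Y) ∈ aff ⁻¹' U₁ := by
    change z₀ + T 0 ∈ U₁
    rwa [map_zero, add_zero]
  -- A cutoff makes `A` globally smooth, as the superposition operator acts on arbitrary curves;
  -- integrability is kept only near the origin.
  obtain ⟨A, hA, hAA⟩ := exists_contDiff_eventuallyEq (f := fun w => A₀ (aff w)) hO hO0
    (hA₀.comp haff.contDiffOn fun w hw => hw)
  obtain ⟨W, hWA, hW, hW0⟩ := eventually_nhds_iff.1 hAA
  have hfrob : ∀ w ∈ W ∩ aff ⁻¹' U₁, ∀ h k : X,
      fderiv ℝ A w (h, A w h) k = fderiv ℝ A w (k, A w k) h := by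
    intro w hw h k
    have h1 : HasFDerivAt A ((fderiv ℝ A₀ (aff w)).comp (T : X × Y →L[ℝ] V)) w :=
      ((hA₀d _ hw.2).comp w (haffd w)).congr_of_eventuallyEq
        (Filter.eventually_of_mem (hW.mem_nhds hw.1) hWA)
    rw [h1.fderiv, hWA w hw.1]
    exact hfrob₀ _ hw.2 h k
  obtain ⟨ψ₀, h00, hψW, hψs, hψt, hψk⟩ := exists_flattening_of_graph hA
    ((hW.inter hO).mem_nhds ⟨hW0, hO0⟩) hfrob
  let τ : V ≃ₜ Y × X := (Homeomorph.addRight (-z₀)).trans L.toHomeomorph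
  have hτ : ∀ z, τ z = L (z + -z₀) := fun z => rfl
  have hτd : ∀ z, HasFDerivAt τ (L : V →L[ℝ] Y × X) z := fun z =>
    L.hasFDerivAt.comp z ((hasFDerivAt_id z).add_const (-z₀))
  have hτs : ContDiff ℝ ∞ τ := L.contDiff.comp (contDiff_id.add contDiff_const)
  have hτt : ContDiff ℝ ∞ τ.symm := L.symm.contDiff.add contDiff_const
  have haffτ : ∀ z, aff (τ z).swap = z := by
    intro z
    change z₀ + L.symm (L (z + -z₀)) = z
    rw [L.symm_apply_apply]
    abel
  refine ⟨τ.transOpenPartialHomeomorph ψ₀, ?_, ?_, ?_, ?_, ?_⟩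
  · change τ z₀ ∈ ψ₀.source
    rw [hτ, add_neg_cancel, map_zero]
    exact h00
  · intro z hz
    have hz : τ z ∈ ψ₀.source := hz
    have := (hψW _ hz).2
    rw [Set.mem_preimage, haffτ] at this
    exact this.1
  · exact hψs.comp hτs.contDiffOn fun z hz => hz
  · exact hτt.comp_contDiffOn hψt
  · intro z hz v
    have hz : τ z ∈ ψ₀.source := hz
    have hw := hψW _ hz
    have hzU : z ∈ U₁ := by
      have := hw.2
      rwa [Set.mem_preimage, haffτ] at this
    have hd : HasFDerivAt ψ₀ (fderiv ℝ ψ₀ (τ z)) (τ z) :=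
      ((hψs.contDiffAt (ψ₀.open_source.mem_nhds hz)).differentiableAt (by simp)).hasFDerivAt
    have hd' : HasFDerivAt (τ.transOpenPartialHomeomorph ψ₀) _ z := hd.comp z (hτd z)
    rw [hd'.fderiv]
    refine (hker z hzU v).trans (Iff.trans ?_ (hψk _ hz (L v)))
    rw [(hWA _ hw.1).trans (congrArg A₀ (haffτ z))]

theorem two_le_infty : (2 : WithTop ℕ∞) ≤ ∞ := by
  exact WithTop.coe_le_coe.2 (le_top : (2 : ℕ∞) ≤ ⊤)

/-! ### Local diffeomorphisms, brackets and smooth families of linear maps. -/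

section LocalDiffeo

open VectorField

variable {V : Type*} [NormedAddCommGroup V] [NormedSpace ℝ V]
  {H : Type*} [TopologicalSpace H] {I : ModelWithCorners ℝ V H}
  {M : Type*} [TopologicalSpace M] [ChartedSpace H M] [IsManifold I ∞ M]
  {V' : Type*} [NormedAddCommGroup V'] [NormedSpace ℝ V']
  {H' : Type*} [TopologicalSpace H'] {I' : ModelWithCorners ℝ V' H'}
  {M' : Type*} [TopologicalSpace M'] [ChartedSpace H' M'] [IsManifold I' ∞ M']
  {V'' : Type*} [NormedAddCommGroup V''] [NormedSpace ℝ V'']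
  {H'' : Type*} [TopologicalSpace H''] {I'' : ModelWithCorners ℝ V'' H''}
  {M'' : Type*} [TopologicalSpace M''] [ChartedSpace H'' M'']

namespace IsLocalDiffeo

variable {ψ : OpenPartialHomeomorph M M'}

omit [IsManifold I ∞ M] [IsManifold I' ∞ M']

theorem symm (h : IsLocalDiffeo I I' ψ) : IsLocalDiffeo I' I ψ.symm := ⟨h.2, h.1⟩

theorem trans {φ : OpenPartialHomeomorph M' M''} (h : IsLocalDiffeo I I' ψ)
    (h' : IsLocalDiffeo I' I'' φ) : IsLocalDiffeo I I'' (ψ.trans φ) := by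
  refine ⟨h'.1.comp (h.1.mono fun x hx => ?_) fun x hx => ?_,
    h.2.comp (h'.2.mono fun x hx => ?_) fun x hx => ?_⟩
  · exact (ψ.trans_source φ ▸ hx).1
  · exact (ψ.trans_source φ ▸ hx).2
  · exact (ψ.trans_target φ ▸ hx).1
  · exact (ψ.trans_target φ ▸ hx).2

theorem restrOpen (h : IsLocalDiffeo I I' ψ) {s : Set M} (hs : IsOpen s) :
    IsLocalDiffeo I I' (ψ.restrOpen s hs) :=
  ⟨h.1.mono Set.inter_subset_left, h.2.mono fun _ hy => hy.1⟩

theorem contMDiffAt (h : IsLocalDiffeo I I' ψ) {x : M} (hx : x ∈ ψ.source) :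
    ContMDiffAt I I' ∞ ψ x := h.1.contMDiffAt (ψ.open_source.mem_nhds hx)

theorem mdifferentiable (h : IsLocalDiffeo I I' ψ) : ψ.MDifferentiable I I' :=
  ⟨h.1.mdifferentiableOn (by simp), h.2.mdifferentiableOn (by simp)⟩

theorem isInvertible (h : IsLocalDiffeo I I' ψ) {x : M} (hx : x ∈ ψ.source) :
    (mfderiv I I' ψ x).IsInvertible := ⟨h.mdifferentiable.mfderiv hx, rfl⟩

end IsLocalDiffeo

theorem InvolutiveOn.mono {D : Distribution I M} {U U' : Set M} (h : InvolutiveOn D U)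
    (hU : U' ⊆ U) : InvolutiveOn D U' := fun W hW hWU => h W hW (hWU.trans hU)

/-- Pulling back a smooth vector field by a local diffeomorphism gives a smooth vector field. -/
theorem IsLocalDiffeo.contMDiffOn_mpullback [CompleteSpace V] {ψ : OpenPartialHomeomorph M M'}
    (h : IsLocalDiffeo I I' ψ) {Y : VField I' M'} {W : Set M'} (hW : IsOpen W)
    (hY : ContMDiffOn I' I'.tangent ∞ (fun x => (⟨x, Y x⟩ : TangentBundle I' M')) W) :
    ContMDiffOn I I.tangent ∞ (fun x => (⟨x, mpullback I I' ψ Y x⟩ : TangentBundle I M))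
      (ψ.source ∩ ψ ⁻¹' W) := by
  have : IsManifold I 1 M := .of_le (n := ∞) (by simp)
  have : IsManifold I' 1 M' := .of_le (n := ∞) (by simp)
  rintro x ⟨hx, hxW⟩
  exact (ContMDiffAt.mpullback_vectorField_preimage (hY.contMDiffAt (hW.mem_nhds hxW))
    (h.contMDiffAt hx) (h.isInvertible hx) (by simp)).contMDiffWithinAt

/-- Involutivity is invariant under local diffeomorphisms. -/
theorem InvolutiveOn.of_isLocalDiffeo [CompleteSpace V] {φ : OpenPartialHomeomorph M M'}
    (h : IsLocalDiffeo I I' φ) {D : Distribution I M} {D' : Distribution I' M'}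
    (hD : ∀ x ∈ φ.source, ∀ v, v ∈ D x ↔ mfderiv I I' φ x v ∈ D' (φ x))
    (hinv : InvolutiveOn D φ.source) : InvolutiveOn D' φ.target := by
  intro W hW hWφ Y Z hY hZ hYD hZD y hy
  have : IsManifold I (minSmoothness ℝ 2) M := .of_le (n := ∞) (by simpa using two_le_infty)
  have : IsManifold I' (minSmoothness ℝ 2) M' := .of_le (n := ∞) (by simpa using two_le_infty)
  obtain ⟨x, hx, rfl⟩ : ∃ x ∈ φ.source, φ x = y :=
    ⟨φ.symm y, φ.map_target (hWφ hy), φ.right_inv (hWφ hy)⟩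
  have hmem : ∀ {T : VField I' M'}, (∀ y ∈ W, T y ∈ D' y) →
      ∀ x ∈ φ.source ∩ φ ⁻¹' W, mpullback I I' φ T x ∈ D x := by
    intro T hT x hx
    rw [hD x hx.1, mpullback_apply, (h.isInvertible hx.1).self_apply_inverse]
    exact hT _ hx.2
  -- The fields are pulled back to the source and bracketed there; pullback commutes with the
  -- bracket.
  have h1 := hinv _ (φ.isOpen_inter_preimage hW) Set.inter_subset_left _ _
    (h.contMDiffOn_mpullback hW hY) (h.contMDiffOn_mpullback hW hZ) (hmem hYD) (hmem hZD) x ⟨hx, hy⟩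
  have hdiff : ∀ {T : VField I' M'},
      ContMDiffOn I' I'.tangent ∞ (fun x => (⟨x, T x⟩ : TangentBundle I' M')) W →
      MDifferentiableAt I' I'.tangent (fun x => (⟨x, T x⟩ : TangentBundle I' M')) (φ x) :=
    fun hT => (hT.contMDiffAt (hW.mem_nhds hy)).mdifferentiableAt (by simp)
  rw [← mpullback_mlieBracket (n := ∞) (hdiff hY) (hdiff hZ) (h.contMDiffAt hx)
    (by simpa using two_le_infty),
    hD x hx, mpullback_apply, (h.isInvertible hx).self_apply_inverse] at h1
  exact h1

section VectorValued

variable {N : Type*} [NormedAddCommGroup N] [NormedSpace ℝ N]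
  {F : Type*} [NormedAddCommGroup F] [NormedSpace ℝ F]

/-- The derivative along a smooth vector field of a smooth vector-valued function is smooth. -/
theorem contMDiffOn_mfderiv_apply {f : M → N} {U : Set M} (hU : IsOpen U)
    (hf : ContMDiffOn I 𝓘(ℝ, N) ∞ f U) {Y : VField I M}
    (hY : ContMDiffOn I I.tangent ∞ (fun x => (⟨x, Y x⟩ : TangentBundle I M)) U) :
    ContMDiffOn I 𝓘(ℝ, N) ∞ (fun x => (mfderiv I 𝓘(ℝ, N) f x (Y x) : N)) U := by
  have : IsManifold I 1 M := .of_le (n := ∞) (by simp)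
  have h1 : ContMDiffOn I 𝓘(ℝ, N).tangent ∞
      (fun x => tangentMapWithin I 𝓘(ℝ, N) f U (⟨x, Y x⟩ : TangentBundle I M)) U :=
    (hf.contMDiffOn_tangentMapWithin (by simp) hU.uniqueMDiffOn).comp hY fun x hx => hx
  have h2 : ContMDiff 𝓘(ℝ, N).tangent 𝓘(ℝ, N) ∞
      (fun v : TangentBundle 𝓘(ℝ, N) N => (v.2 : N)) := fun v => by
    simpa using (Bundle.contMDiffAt_totalSpace.1
      (contMDiffAt_id (I := 𝓘(ℝ, N).tangent) (n := ∞) (x := v))).2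
  refine (h2.comp_contMDiffOn h1).congr fun x hx => ?_
  simp only [Function.comp, tangentMapWithin, mfderivWithin_of_isOpen hU hx]
  rfl

omit [IsManifold I ∞ M] in
/-- A family of linear maps on a finite-dimensional space is smooth if it is pointwise smooth. -/
theorem contMDiffOn_clm_of_apply [FiniteDimensional ℝ N] {G : M → N →L[ℝ] F} {U : Set M}
    (h : ∀ v, ContMDiffOn I 𝓘(ℝ, F) ∞ (fun x => G x v) U) :
    ContMDiffOn I 𝓘(ℝ, N →L[ℝ] F) ∞ G U := by
  let b := Module.finBasis ℝ N
  have hG : G = fun x => ∑ i, ContinuousLinearMap.smulRightL ℝ N F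
      (LinearMap.toContinuousLinearMap (b.coord i)) (G x (b i)) := by
    funext x
    refine ContinuousLinearMap.ext fun v => ?_
    simp only [sum_apply, ContinuousLinearMap.smulRightL_apply_apply]
    conv_lhs => rw [← b.sum_repr v, map_sum]
    simp only [map_smul]
    rfl
  rw [hG]
  exact contMDiffOn_finsetSum fun i _ => ContMDiffOn.comp (t := Set.univ)
    (ContinuousLinearMap.contMDiff _).contMDiffOn (h (b i)) fun _ _ => trivial

omit [IsManifold I ∞ M] in
/-- The inverses of a smooth family of invertible linear maps form a smooth family. -/
theorem contMDiffOn_clm_inverse [CompleteSpace N] {G : M → N →L[ℝ] F} {U : Set M}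
    (hG : ContMDiffOn I 𝓘(ℝ, N →L[ℝ] F) ∞ G U) (hinv : ∀ x ∈ U, (G x).IsInvertible) :
    ContMDiffOn I 𝓘(ℝ, F →L[ℝ] N) ∞ (fun x => (G x).inverse) U := by
  intro x hx
  obtain ⟨e, he⟩ := hinv x hx
  have h1 : ContDiffAt ℝ ∞ ContinuousLinearMap.inverse (G x) := he ▸ contDiffAt_map_inverse e
  exact h1.contMDiffAt.comp_contMDiffWithinAt x (hG x hx)

omit [IsManifold I ∞ M] in
/-- The matrices of the inverses of a smooth family of invertible linear maps. -/
theorem isSmoothGL_inverse {k : ℕ} {G : M → (Fin k → ℝ) →L[ℝ] (Fin k → ℝ)} {U : Set M}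
    (hG : ContMDiffOn I 𝓘(ℝ, (Fin k → ℝ) →L[ℝ] (Fin k → ℝ)) ∞ G U)
    (hinv : ∀ x ∈ U, (G x).IsInvertible) :
    IsSmoothGL (I := I)
      (fun x => LinearMap.toMatrix' ((G x).inverse : (Fin k → ℝ) →ₗ[ℝ] (Fin k → ℝ))) U := by
  refine ⟨fun i j => ?_, fun x hx => ?_⟩
  · have h1 := contMDiffOn_clm_inverse hG hinv
    have h2 : ContMDiffOn I 𝓘(ℝ, Fin k → ℝ) ∞ (fun x => (G x).inverse (Pi.single j 1)) U :=
      h1.clm_apply contMDiffOn_const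
    refine (contMDiffOn_pi_space.1 h2 i).congr fun x _ => ?_
    change LinearMap.toMatrix' _ i j = _
    rw [LinearMap.toMatrix'_apply]
    rfl
  · have h1 : LinearMap.toMatrix' ((G x).inverse : (Fin k → ℝ) →ₗ[ℝ] (Fin k → ℝ)) *
        LinearMap.toMatrix' (G x : (Fin k → ℝ) →ₗ[ℝ] (Fin k → ℝ)) = 1 := by
      rw [← LinearMap.toMatrix'_comp, ← LinearMap.toMatrix'_id]
      congr 1
      exact LinearMap.ext fun v => (hinv x hx).inverse_apply_self v
    exact IsUnit.of_mul_eq_one _ h1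

end VectorValued

theorem DAE.contMDiffOn_apply {l : ℕ} (Ξ : DAE I M l) {U : Set M} (hU : U ⊆ Ξ.X) {Y : VField I M}
    (hY : ContMDiffOn I I.tangent ∞ (fun x => (⟨x, Y x⟩ : TangentBundle I M)) U) :
    ContMDiffOn I 𝓘(ℝ, Fin l → ℝ) ∞ (fun x => Ξ.E x (Y x)) U :=
  Ξ.smooth_E.comp hY fun _ hx => hU hx

/-- The one-form of a DAE in the coordinates given by a local diffeomorphism to a vector space. -/
def DAE.coordE {l : ℕ} (Ξ : DAE I M l) {N : Type*} [NormedAddCommGroup N] [NormedSpace ℝ N]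
    (ψ : OpenPartialHomeomorph M N) (x : M) : N →L[ℝ] (Fin l → ℝ) :=
  (Ξ.E x).comp (mfderiv I 𝓘(ℝ, N) ψ x).inverse

section Coord

variable {N : Type*} [NormedAddCommGroup N] [NormedSpace ℝ N] {l : ℕ} (Ξ : DAE I M l)
  {ψ : OpenPartialHomeomorph M N}

theorem DAE.coordE_mfderiv (hψ : IsLocalDiffeo I 𝓘(ℝ, N) ψ) {x : M} (hx : x ∈ ψ.source)
    (v : TangentSpace I x) : Ξ.coordE ψ x (mfderiv I 𝓘(ℝ, N) ψ x v) = Ξ.E x v :=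
  congrArg (Ξ.E x) ((hψ.isInvertible hx).inverse_apply_self v)

/-- On a fixed vector `u` the family is `E` applied to the pullback of the constant field `u`, which
is smooth; finite dimension upgrades this to smoothness in operator norm. -/
theorem DAE.contMDiffOn_coordE [CompleteSpace V] [FiniteDimensional ℝ N]
    (hψ : IsLocalDiffeo I 𝓘(ℝ, N) ψ) :
    ContMDiffOn I 𝓘(ℝ, N →L[ℝ] (Fin l → ℝ)) ∞ (Ξ.coordE ψ) (ψ.source ∩ Ξ.X) := by
  refine contMDiffOn_clm_of_apply fun u => ?_
  have h1 := hψ.contMDiffOn_mpullback isOpen_univ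
    (contMDiffOn_vectorSpace_iff_contDiffOn.2 (contDiffOn_const (c := u)))
  exact Ξ.contMDiffOn_apply Set.inter_subset_right (h1.mono fun x hx => ⟨hx.1, trivial⟩)

end Coord

end LocalDiffeo

/-! ### Charts that straighten the kernel. -/

section Flattening

open VectorField

theorem mlieBracket_eq_lieBracket {N : Type*} [NormedAddCommGroup N] [NormedSpace ℝ N]
    (Y Z : N → N) (z : N) : mlieBracket 𝓘(ℝ, N) Y Z z = lieBracket ℝ Y Z z := by
  have h := congrFun (mlieBracketWithin_eq_lieBracketWithin (𝕜 := ℝ) (V := Y) (W := Z)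
    (s := Set.univ)) z
  exact (congrFun (mlieBracketWithin_univ (I := 𝓘(ℝ, N)) (V := Y) (W := Z)) z).symm.trans <|
    h.trans (congrFun (lieBracketWithin_univ (𝕜 := ℝ) (V := Y) (W := Z)) z)

/-- The Lie bracket of vector fields on a product whose first components vanish. -/
theorem lieBracket_fst_eq_zero {A B : Type*} [NormedAddCommGroup A] [NormedSpace ℝ A]
    [NormedAddCommGroup B] [NormedSpace ℝ B] {Y Z : A × B → A × B} {W : Set (A × B)}
    (hW : IsOpen W) (hY : ContDiffOn ℝ ∞ Y W) (hZ : ContDiffOn ℝ ∞ Z W)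
    (hY0 : ∀ w ∈ W, (Y w).1 = 0) (hZ0 : ∀ w ∈ W, (Z w).1 = 0) {z : A × B} (hz : z ∈ W) :
    (lieBracket ℝ Y Z z).1 = 0 := by
  have key : ∀ {T : A × B → A × B}, ContDiffOn ℝ ∞ T W → (∀ w ∈ W, (T w).1 = 0) → ∀ u,
      (fderiv ℝ T z u).1 = 0 := by
    intro T hT hT0 u
    have h1 : HasFDerivAt T (fderiv ℝ T z) z :=
      ((hT.contDiffAt (hW.mem_nhds hz)).differentiableAt (by simp)).hasFDerivAt
    have h2 : HasFDerivAt (fun w => (T w).1) (0 : A × B →L[ℝ] A) z :=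
      (hasFDerivAt_const 0 z).congr_of_eventuallyEq
        (Filter.eventually_of_mem (hW.mem_nhds hz) hT0)
    exact DFunLike.congr_fun (h1.fst.unique h2) u
  rw [lieBracket, Prod.fst_sub, key hZ hZ0, key hY hY0, sub_zero]

/-- The derivative of a vector-valued function on a manifold, with values in that vector space. -/
def coordDeriv {V : Type*} [NormedAddCommGroup V] [NormedSpace ℝ V]
    {H : Type*} [TopologicalSpace H] (I : ModelWithCorners ℝ V H)
    {M : Type*} [TopologicalSpace M] [ChartedSpace H M]
    {N : Type*} [NormedAddCommGroup N] [NormedSpace ℝ N] (ψ : M → N) (x : M) :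
    TangentSpace I x →L[ℝ] N :=
  mfderiv I 𝓘(ℝ, N) ψ x

variable {V : Type*} [NormedAddCommGroup V] [NormedSpace ℝ V]
  {H : Type*} [TopologicalSpace H] {I : ModelWithCorners ℝ V H}
  {M : Type*} [TopologicalSpace M] [ChartedSpace H M] [IsManifold I ∞ M]
  {l q m : ℕ}

theorem DAE.finrank_range_coordE (Ξ : DAE I M l) {N : Type*} [NormedAddCommGroup N]
    [NormedSpace ℝ N] {ψ : OpenPartialHomeomorph M N} (hψ : IsLocalDiffeo I 𝓘(ℝ, N) ψ) {x : M}
    (hx : x ∈ ψ.source) :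
    Module.finrank ℝ (LinearMap.range (Ξ.coordE ψ x : N →ₗ[ℝ] (Fin l → ℝ))) = Ξ.rankE x := by
  have h : LinearMap.range (Ξ.coordE ψ x : N →ₗ[ℝ] (Fin l → ℝ)) =
      LinearMap.range (Ξ.E x : TangentSpace I x →ₗ[ℝ] (Fin l → ℝ)) := by
    ext y
    constructor
    · rintro ⟨u, hu⟩
      exact ⟨(mfderiv I 𝓘(ℝ, N) ψ x).inverse u, hu⟩
    · rintro ⟨v, hv⟩
      exact ⟨mfderiv I 𝓘(ℝ, N) ψ x v, (Ξ.coordE_mfderiv hψ hx v).trans hv⟩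
  rw [h]
  rfl

/-- `ψ` is a local diffeomorphism to `ℝ^q × ℝ^m` that maps the kernel of `E` to `0 × ℝ^m`. -/
structure DAE.Flattens (Ξ : DAE I M l)
    (ψ : OpenPartialHomeomorph M (EuclideanSpace ℝ (Fin q) × EuclideanSpace ℝ (Fin m))) :
    Prop where
  isLocalDiffeo : IsLocalDiffeo I 𝓘(ℝ, EuclideanSpace ℝ (Fin q) × EuclideanSpace ℝ (Fin m)) ψ
  source_subset : ψ.source ⊆ Ξ.X
  apply_eq_zero_iff : ∀ x ∈ ψ.source, ∀ v : TangentSpace I x,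
    Ξ.E x v = 0 ↔ (coordDeriv I ψ x v).1 = 0

/-- The kernel of `E` can be flattened if it is an involutive distribution of constant rank. -/
theorem exists_flattens {n : ℕ} {M : Type*} [TopologicalSpace M]
    [ChartedSpace (EuclideanSpace ℝ (Fin n)) M] [IsManifold (𝓡 n) ∞ M] (Ξ : DAE (𝓡 n) M l)
    {U : Set M} (hU : IsOpen U) {x₀ : M} (hx₀ : x₀ ∈ U) (hUX : U ⊆ Ξ.X) {q : ℕ}
    (hq : ∀ x ∈ U, Ξ.rankE x = q) (hinv : InvolutiveOn Ξ.kerE U) :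
    ∃ (m : ℕ) (ψ : OpenPartialHomeomorph M
      (EuclideanSpace ℝ (Fin q) × EuclideanSpace ℝ (Fin m))),
      q + m = n ∧ x₀ ∈ ψ.source ∧ Ξ.Flattens ψ := by
  let φ := (chartAt (EuclideanSpace ℝ (Fin n)) x₀).restrOpen U hU
  have hφ : IsLocalDiffeo (𝓡 n) (𝓡 n) φ :=
    IsLocalDiffeo.restrOpen ⟨contMDiffOn_chart, contMDiffOn_chart_symm⟩ hU
  have hφU : φ.source ⊆ U := Set.inter_subset_right
  have hx₀φ : x₀ ∈ φ.source := ⟨mem_chart_source _ x₀, hx₀⟩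
  let E' : EuclideanSpace ℝ (Fin n) → EuclideanSpace ℝ (Fin n) →L[ℝ] (Fin l → ℝ) :=
    fun z => Ξ.coordE φ (φ.symm z)
  have hE' : ContDiffOn ℝ ∞ E' φ.target := by
    rw [← contMDiffOn_iff_contDiffOn]
    exact (Ξ.contMDiffOn_coordE hφ).comp hφ.2 fun z hz =>
      ⟨φ.map_target hz, hUX (hφU (φ.map_target hz))⟩
  have hE'φ : ∀ x ∈ φ.source, ∀ v : TangentSpace (𝓡 n) x,
      E' (φ x) (coordDeriv (𝓡 n) φ x v) = Ξ.E x v := by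
    intro x hx v
    have h1 : E' (φ x) = Ξ.coordE φ x := congrArg (Ξ.coordE φ) (φ.left_inv hx)
    rw [h1]
    exact Ξ.coordE_mfderiv hφ hx v
  have hrank : ∀ z ∈ φ.target, Module.finrank ℝ (LinearMap.range
      (E' z : EuclideanSpace ℝ (Fin n) →ₗ[ℝ] (Fin l → ℝ))) = q := by
    intro z hz
    have hx := φ.map_target hz
    rw [← hq _ (hφU hx)]
    exact Ξ.finrank_range_coordE hφ hx
  let D : Distribution (𝓡 n) (EuclideanSpace ℝ (Fin n)) := fun z =>
    LinearMap.ker (E' z : EuclideanSpace ℝ (Fin n) →ₗ[ℝ] (Fin l → ℝ))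
  have hD : InvolutiveOn D φ.target := by
    refine (hinv.mono hφU).of_isLocalDiffeo hφ fun x hx v => ?_
    change Ξ.E x v = 0 ↔ E' (φ x) (coordDeriv (𝓡 n) φ x v) = 0
    rw [hE'φ x hx v]
  -- This gives `q ≤ n`, hence the number `m` of kernel coordinates.
  have hker : Module.finrank ℝ (LinearMap.range
      (E' (φ x₀) : EuclideanSpace ℝ (Fin n) →ₗ[ℝ] (Fin l → ℝ))) ≤
      Module.finrank ℝ (EuclideanSpace ℝ (Fin n)) := LinearMap.finrank_range_le _
  rw [hrank _ (φ.map_source hx₀φ), finrank_euclideanSpace_fin] at hker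
  obtain ⟨m, hm⟩ := Nat.exists_eq_add_of_le hker
  obtain ⟨ψ, h0, hsrc, hs, ht, hk⟩ := exists_flattening φ.open_target (φ.map_source hx₀φ) hE' hrank
    (m := m) (by rw [finrank_euclideanSpace_fin, hm]) (by
      intro O hO hOφ Z₁ Z₂ hZ₁ hZ₂ hZ₁E hZ₂E z hz
      have h1 := hD O hO hOφ Z₁ Z₂ (contMDiffOn_vectorSpace_iff_contDiffOn.2 hZ₁)
        (contMDiffOn_vectorSpace_iff_contDiffOn.2 hZ₂) hZ₁E hZ₂E z hz
      exact mlieBracket_eq_lieBracket Z₁ Z₂ z ▸ h1)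
  have hψ : IsLocalDiffeo (𝓡 n) 𝓘(ℝ, EuclideanSpace ℝ (Fin q) × EuclideanSpace ℝ (Fin m)) ψ :=
    ⟨hs.contMDiffOn, ht.contMDiffOn⟩
  refine ⟨m, φ.trans ψ, hm.symm, ?_, hφ.trans hψ, ?_, ?_⟩
  · rw [φ.trans_source]
    exact ⟨hx₀φ, h0⟩
  · rw [φ.trans_source]
    exact fun x hx => hUX (hφU hx.1)
  · intro x hx v
    rw [φ.trans_source] at hx
    have h1 : coordDeriv (𝓡 n) (φ.trans ψ) x v = fderiv ℝ ψ (φ x) (coordDeriv (𝓡 n) φ x v) := by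
      have h2 : mfderiv (𝓡 n) 𝓘(ℝ, EuclideanSpace ℝ (Fin q) × EuclideanSpace ℝ (Fin m))
          (ψ ∘ φ) x = _ := mfderiv_comp x
        (hψ.mdifferentiable.mdifferentiableAt hx.2) (hφ.mdifferentiable.mdifferentiableAt hx.1)
      rw [mfderiv_eq_fderiv] at h2
      exact DFunLike.congr_fun h2 v
    rw [h1, ← hk _ hx.2, hE'φ x hx.1 v]

namespace DAE.Flattens

variable {Ξ : DAE I M l}
  {ψ : OpenPartialHomeomorph M (EuclideanSpace ℝ (Fin q) × EuclideanSpace ℝ (Fin m))}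

theorem restrOpen (h : Ξ.Flattens ψ) {s : Set M} (hs : IsOpen s) :
    Ξ.Flattens (ψ.restrOpen s hs) :=
  ⟨h.isLocalDiffeo.restrOpen hs, Set.inter_subset_left.trans h.source_subset,
    fun x hx v => h.apply_eq_zero_iff x hx.1 v⟩

/-- The derivative of `ψ` as a linear equivalence. -/
def equiv (h : Ξ.Flattens ψ) {x : M} (hx : x ∈ ψ.source) :
    TangentSpace I x ≃L[ℝ] (EuclideanSpace ℝ (Fin q) × EuclideanSpace ℝ (Fin m)) :=
  h.isLocalDiffeo.mdifferentiable.mfderiv hx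

theorem equiv_apply (h : Ξ.Flattens ψ) {x : M} (hx : x ∈ ψ.source) (v : TangentSpace I x) :
    h.equiv hx v = coordDeriv I ψ x v := rfl

/-- The kernel of `E` is involutive if it can be flattened. -/
theorem involutiveOn [CompleteSpace V] (h : Ξ.Flattens ψ) : InvolutiveOn Ξ.kerE ψ.source := by
  let N := EuclideanSpace ℝ (Fin q) × EuclideanSpace ℝ (Fin m)
  let D : Distribution 𝓘(ℝ, N) N := fun _ => LinearMap.ker (LinearMap.fst ℝ
    (EuclideanSpace ℝ (Fin q)) (EuclideanSpace ℝ (Fin m)))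
  have hD : InvolutiveOn D ψ.symm.source := by
    intro W hW _ Y Z hY hZ hYD hZD z hz
    rw [contMDiffOn_vectorSpace_iff_contDiffOn] at hY hZ
    exact (congrArg Prod.fst (mlieBracket_eq_lieBracket (N := N) Y Z z)).trans
      (lieBracket_fst_eq_zero hW hY hZ hYD hZD hz)
  -- The model distribution of vectors with zero first component is involutive, and it is carried
  -- back to `ker E` by `ψ.symm`.
  refine hD.of_isLocalDiffeo h.isLocalDiffeo.symm fun z hz v => ?_
  have hx : ψ.symm z ∈ ψ.source := ψ.map_target hz
  have h1 := DFunLike.congr_fun (h.isLocalDiffeo.mdifferentiable.comp_symm_deriv hz) v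
  exact (iff_of_eq (congrArg (fun w : N => w.1 = 0) h1.symm)).trans
    (h.apply_eq_zero_iff _ hx _).symm

end DAE.Flattens

end Flattening

/-! ### From a straightening chart to a semi-explicit equation. -/

section SemiExplicit

/-- Stacking vectors as a linear equivalence `ℝ^q × ℝ^p ≃ ℝˡ`. -/
def stackEquiv {q p l : ℕ} (hl : q + p = l) :
    ((Fin q → ℝ) × (Fin p → ℝ)) ≃L[ℝ] (Fin l → ℝ) :=
  LinearEquiv.toContinuousLinearEquiv
    { toFun := fun w => stack hl w.1 w.2
      invFun := fun w => (fun i => w (Fin.cast hl (Fin.castAdd p i)),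
        fun j => w (Fin.cast hl (Fin.natAdd q j)))
      map_add' := by
        intro v w
        subst hl
        funext i
        refine Fin.addCases (fun j => ?_) (fun j => ?_) i <;> simp [stack]
      map_smul' := by
        intro c v
        subst hl
        funext i
        refine Fin.addCases (fun j => ?_) (fun j => ?_) i <;> simp [stack]
      left_inv := by
        intro w
        subst hl
        ext i <;> simp [stack]
      right_inv := by
        intro w
        subst hl
        funext i
        refine Fin.addCases (fun j => ?_) (fun j => ?_) i <;> simp [stack] }

theorem stackEquiv_apply {q p l : ℕ} (hl : q + p = l) (w : (Fin q → ℝ) × (Fin p → ℝ)) :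
    stackEquiv hl w = stack hl w.1 w.2 := rfl

theorem stack_zero_eq_zero_iff {q p l : ℕ} (hl : q + p = l) (a : Fin q → ℝ) :
    stack hl a 0 = 0 ↔ a = 0 := by
  have h : stackEquiv hl (a, 0) = 0 ↔ (a, (0 : Fin p → ℝ)) = 0 := (stackEquiv hl).map_eq_zero_iff
  rw [stackEquiv_apply] at h
  exact h.trans ⟨fun h' => congrArg Prod.fst h', fun h' => Prod.ext h' rfl⟩

theorem semiExplicitE_apply {q p l m : ℕ} (hl : q + p = l)
    (v : EuclideanSpace ℝ (Fin q) × EuclideanSpace ℝ (Fin m)) :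
    semiExplicitE m hl v = stack hl (EuclideanSpace.equiv (Fin q) ℝ v.1) 0 := rfl

/-- An injective linear map `ℝ^q → ℝˡ` extends to a bijective one on `ℝ^q × ℝ^p`, `q + p = l`. -/
theorem exists_injective_coprod {q p l : ℕ} (hl : q + p = l) (B : (Fin q → ℝ) →L[ℝ] (Fin l → ℝ))
    (hB : Function.Injective B) :
    ∃ C : (Fin p → ℝ) →L[ℝ] (Fin l → ℝ), Function.Injective (B.coprod C) := by
  obtain ⟨N, hN⟩ := Submodule.exists_isCompl (LinearMap.range (B : (Fin q → ℝ) →ₗ[ℝ] (Fin l → ℝ)))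
  have h1 := Submodule.finrank_add_eq_of_isCompl hN
  rw [LinearMap.finrank_range_of_inj hB, Module.finrank_fin_fun, Module.finrank_fin_fun] at h1
  let e : (Fin p → ℝ) ≃ₗ[ℝ] N := LinearEquiv.ofFinrankEq _ _ (by
    rw [Module.finrank_fin_fun]
    omega)
  refine ⟨LinearMap.toContinuousLinearMap (N.subtype.comp e.toLinearMap), ?_⟩
  rw [injective_iff_map_eq_zero]
  rintro ⟨a, b⟩ hab
  have hab : B a + (e b : Fin l → ℝ) = 0 := hab
  have h2 : B a = 0 := by
    have h3 : B a ∈ N := by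
      rw [eq_neg_of_add_eq_zero_left hab]
      exact N.neg_mem (e b).2
    exact (Submodule.disjoint_def.1 hN.disjoint) _ ⟨a, rfl⟩ h3
  rw [h2, zero_add] at hab
  exact Prod.ext (hB (h2.trans (map_zero B).symm)) (e.map_eq_zero_iff.1 (Subtype.ext hab))

variable {V : Type*} [NormedAddCommGroup V] [NormedSpace ℝ V]
  {H : Type*} [TopologicalSpace H] {I : ModelWithCorners ℝ V H}
  {M : Type*} [TopologicalSpace M] [ChartedSpace H M] [IsManifold I ∞ M]
  {l q m p : ℕ} {Ξ : DAE I M l}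

theorem DAE.Flattens.coordE_eq_zero_iff
    {ψ : OpenPartialHomeomorph M (EuclideanSpace ℝ (Fin q) × EuclideanSpace ℝ (Fin m))}
    (h : Ξ.Flattens ψ) {x : M} (hx : x ∈ ψ.source)
    (w : EuclideanSpace ℝ (Fin q) × EuclideanSpace ℝ (Fin m)) :
    Ξ.coordE ψ x w = 0 ↔ w.1 = 0 := by
  obtain ⟨v, rfl⟩ := (h.equiv hx).surjective w
  rw [h.equiv_apply, ← h.apply_eq_zero_iff x hx v, ← Ξ.coordE_mfderiv h.isLocalDiffeo hx v]
  rfl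

/-- A DAE whose kernel can be flattened is locally externally equivalent to a semi-explicit one. -/
theorem DAE.Flattens.exists_semiExplicit [CompleteSpace V]
    {ψ : OpenPartialHomeomorph M (EuclideanSpace ℝ (Fin q) × EuclideanSpace ℝ (Fin m))}
    (h : Ξ.Flattens ψ) {x₀ : M} (hx₀ : x₀ ∈ ψ.source) :
    ∃ (p : ℕ) (hl : q + p = l)
      (X₁ : TopologicalSpace.Opens (EuclideanSpace ℝ (Fin q)))
      (X₂ : TopologicalSpace.Opens (EuclideanSpace ℝ (Fin m)))
      (F₁ : EuclideanSpace ℝ (Fin q) × EuclideanSpace ℝ (Fin m) → Fin q → ℝ)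
      (F₂ : EuclideanSpace ℝ (Fin q) × EuclideanSpace ℝ (Fin m) → Fin p → ℝ)
      (hF₁ : ContDiffOn ℝ ∞ F₁ ((X₁ : Set _) ×ˢ (X₂ : Set _)))
      (hF₂ : ContDiffOn ℝ ∞ F₂ ((X₁ : Set _) ×ˢ (X₂ : Set _)))
      (z₀ : EuclideanSpace ℝ (Fin q) × EuclideanSpace ℝ (Fin m)),
      LocallyExEquivalent Ξ x₀ (semiExplicit hl X₁ X₂ F₁ F₂ hF₁ hF₂) z₀ := by
  let Y := EuclideanSpace ℝ (Fin q)
  let N := EuclideanSpace ℝ (Fin q) × EuclideanSpace ℝ (Fin m)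
  let eY : Y ≃L[ℝ] (Fin q → ℝ) := EuclideanSpace.equiv (Fin q) ℝ
  let j : (Fin q → ℝ) →L[ℝ] N := (ContinuousLinearMap.inl ℝ _ _).comp (eY.symm : _ →L[ℝ] Y)
  have hBinj : Function.Injective ((Ξ.coordE ψ x₀).comp j) := by
    rw [injective_iff_map_eq_zero]
    intro a ha
    exact eY.symm.map_eq_zero_iff.1 ((h.coordE_eq_zero_iff hx₀ _).1 ha)
  have hle : q ≤ l := by
    have := LinearMap.finrank_le_finrank_of_injective
      (f := ((Ξ.coordE ψ x₀).comp j : (Fin q → ℝ) →ₗ[ℝ] (Fin l → ℝ))) hBinj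
    rwa [Module.finrank_fin_fun, Module.finrank_fin_fun] at this
  obtain ⟨p, hp⟩ := Nat.exists_eq_add_of_le hle
  have hl : q + p = l := hp.symm
  obtain ⟨C, hC⟩ := exists_injective_coprod hl _ hBinj
  let σ := stackEquiv hl
  let J₁ : (Fin l → ℝ) →L[ℝ] N := j.comp ((ContinuousLinearMap.fst ℝ _ _).comp
    (σ.symm : _ →L[ℝ] (Fin q → ℝ) × (Fin p → ℝ)))
  let J₂ : (Fin l → ℝ) →L[ℝ] (Fin l → ℝ) := C.comp ((ContinuousLinearMap.snd ℝ _ _).comp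
    (σ.symm : _ →L[ℝ] (Fin q → ℝ) × (Fin p → ℝ)))
  -- `K x` sends the stacked `(a, b)` to `E (a, 0) + C b`, with `C` chosen once, complementary at
  -- `x₀`. Invertibility persists nearby, and `Q = K⁻¹` maps `E (a, 0)` to `(a, 0)`.
  let K : M → (Fin l → ℝ) →L[ℝ] (Fin l → ℝ) := fun x => (Ξ.coordE ψ x).comp J₁ + J₂
  have hKs : ContMDiffOn I 𝓘(ℝ, (Fin l → ℝ) →L[ℝ] (Fin l → ℝ)) ∞ K ψ.source :=
    (((Ξ.contMDiffOn_coordE h.isLocalDiffeo).mono fun x hx => ⟨hx, h.source_subset hx⟩).clm_comp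
      contMDiffOn_const).add contMDiffOn_const
  have hK₀ : (K x₀).IsInvertible := by
    have hinj : Function.Injective (K x₀ : (Fin l → ℝ) →ₗ[ℝ] (Fin l → ℝ)) :=
      fun a b hab => σ.symm.injective (hC hab)
    exact ⟨(LinearEquiv.ofInjectiveEndo _ hinj).toContinuousLinearEquiv, rfl⟩
  let O := ψ.source ∩ K ⁻¹' Set.range
    ((↑) : ((Fin l → ℝ) ≃L[ℝ] (Fin l → ℝ)) → (Fin l → ℝ) →L[ℝ] (Fin l → ℝ))
  have hO : IsOpen O :=
    hKs.continuousOn.isOpen_inter_preimage ψ.open_source ContinuousLinearEquiv.isOpen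
  let ψ' := ψ.restrOpen O hO
  have hO' : ∀ x ∈ ψ'.source, (K x).IsInvertible := fun x hx => hx.2.2
  have h' : Ξ.Flattens ψ' := h.restrOpen hO
  have hx₀' : x₀ ∈ ψ'.source := ⟨hx₀, hx₀, hK₀⟩
  have hKs' : ContMDiffOn I 𝓘(ℝ, (Fin l → ℝ) →L[ℝ] (Fin l → ℝ)) ∞ K ψ'.source :=
    hKs.mono Set.inter_subset_left
  let Ft : N → Fin l → ℝ := fun z => (K (ψ'.symm z)).inverse (Ξ.F (ψ'.symm z))
  have hFt : ContDiffOn ℝ ∞ Ft ψ'.target := by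
    rw [← contMDiffOn_iff_contDiffOn]
    exact ((contMDiffOn_clm_inverse hKs' hO').clm_apply (Ξ.smooth_F.mono h'.source_subset)).comp
      h'.isLocalDiffeo.2 fun z hz => ψ'.map_target hz
  -- The semi-explicit form lives on a box, so the chart is shrunk to the preimage of one inside its
  -- target.
  obtain ⟨X₁, X₂, hX₁, hX₂, hz₁, hz₂, hX⟩ :=
    isOpen_prod_iff.1 ψ'.open_target (ψ' x₀).1 (ψ' x₀).2 (ψ'.map_source hx₀')
  have hs : ContDiffOn ℝ ∞ (fun z => σ.symm (Ft z)) (X₁ ×ˢ X₂) :=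
    σ.symm.contDiff.comp_contDiffOn (hFt.mono hX)
  have hO₂ : IsOpen (ψ'.source ∩ ψ' ⁻¹' (X₁ ×ˢ X₂)) := ψ'.isOpen_inter_preimage (hX₁.prod hX₂)
  let ψ₂ := ψ'.restrOpen _ hO₂
  have h₂ : Ξ.Flattens ψ₂ := h'.restrOpen hO₂
  have hsrc : ψ₂.source ⊆ ψ'.source := Set.inter_subset_left
  refine ⟨p, hl, ⟨X₁, hX₁⟩, ⟨X₂, hX₂⟩, fun z => (σ.symm (Ft z)).1, fun z => (σ.symm (Ft z)).2,
    contDiff_fst.comp_contDiffOn hs, contDiff_snd.comp_contDiffOn hs, ψ₂ x₀, ψ₂,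
    fun x => LinearMap.toMatrix' ((K x).inverse : (Fin l → ℝ) →ₗ[ℝ] (Fin l → ℝ)),
    h₂.isLocalDiffeo, isSmoothGL_inverse (hKs'.mono hsrc) fun x hx => hO' x (hsrc hx),
    ⟨hx₀', hx₀', hz₁, hz₂⟩, rfl, h₂.source_subset, ?_, fun x hx => ⟨fun v => ?_, ?_⟩⟩
  · intro z hz
    have h3 := (ψ₂.map_target hz).2.2
    have h4 : ψ' (ψ₂.symm z) = z := ψ₂.right_inv hz
    rwa [Set.mem_preimage, h4] at h3
  · rw [LinearMap.toMatrix'_mulVec]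
    have hxψ : x ∈ ψ.source := hx.1.1
    change semiExplicitE m hl (coordDeriv I ψ x v) = (K x).inverse (Ξ.E x v)
    rw [semiExplicitE_apply, eq_comm, (hO' x (hsrc hx)).inverse_apply_eq,
      ← Ξ.coordE_mfderiv h.isLocalDiffeo hxψ v]
    change Ξ.coordE ψ x (coordDeriv I ψ x v) = Ξ.coordE ψ x (J₁ (σ (_, 0))) + J₂ (σ (_, 0))
    have h5 : J₂ (σ (eY (coordDeriv I ψ x v).1, 0)) = 0 := by
      change C (σ.symm (σ (_, 0))).2 = 0
      rw [σ.symm_apply_apply, map_zero]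
    have h6 : J₁ (σ (eY (coordDeriv I ψ x v).1, 0)) = ((coordDeriv I ψ x v).1, 0) := by
      change (eY.symm (σ.symm (σ (_, 0))).1, (0 : EuclideanSpace ℝ (Fin m))) = _
      rw [σ.symm_apply_apply, eY.symm_apply_apply]
    -- Dropping the `x₂`-part of `dψ v` does not change the value of `E`, because that part lies in
    -- the kernel.
    rw [show J₂ (σ (_, 0)) = 0 from h5, show J₁ (σ (_, 0)) = _ from h6, add_zero, ← sub_eq_zero,
      ← map_sub, h.coordE_eq_zero_iff hxψ]
    simp
  · rw [LinearMap.toMatrix'_mulVec]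
    change σ (σ.symm (Ft (ψ' x))) = (K x).inverse (Ξ.F x)
    rw [σ.apply_symm_apply]
    change (K (ψ'.symm (ψ' x))).inverse (Ξ.F (ψ'.symm (ψ' x))) = _
    rw [ψ'.left_inv (hsrc hx)]

end SemiExplicit

/-! ### Explicitations and their full reduction. -/

section Explicitation

open VectorField

variable {V : Type*} [NormedAddCommGroup V] [NormedSpace ℝ V]
  {H : Type*} [TopologicalSpace H] {I : ModelWithCorners ℝ V H}
  {M : Type*} [TopologicalSpace M] [ChartedSpace H M] [IsManifold I ∞ M]
  {l q m p : ℕ} {Ξ : DAE I M l}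

theorem euclidean_prod_eq_sum (v : EuclideanSpace ℝ (Fin q) × EuclideanSpace ℝ (Fin m))
    (hv : v.1 = 0) :
    v = ∑ i, v.2 i • ((0, EuclideanSpace.single i 1) :
      EuclideanSpace ℝ (Fin q) × EuclideanSpace ℝ (Fin m)) := by
  refine Prod.ext ?_ ?_
  · rw [Prod.fst_sum, hv]
    simp
  · ext j
    rw [Prod.snd_sum]
    simp [Pi.single_apply]

/-- If a DAE is locally externally equivalent to a semi-explicit one, its kernel is flattened. -/
theorem LocallyExEquivalent.exists_flattens {hl : q + p = l}
    {X₁ : TopologicalSpace.Opens (EuclideanSpace ℝ (Fin q))}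
    {X₂ : TopologicalSpace.Opens (EuclideanSpace ℝ (Fin m))}
    {F₁ : EuclideanSpace ℝ (Fin q) × EuclideanSpace ℝ (Fin m) → Fin q → ℝ}
    {F₂ : EuclideanSpace ℝ (Fin q) × EuclideanSpace ℝ (Fin m) → Fin p → ℝ}
    {hF₁ : ContDiffOn ℝ ∞ F₁ ((X₁ : Set _) ×ˢ (X₂ : Set _))}
    {hF₂ : ContDiffOn ℝ ∞ F₂ ((X₁ : Set _) ×ˢ (X₂ : Set _))} {x₀ : M}
    {z₀ : EuclideanSpace ℝ (Fin q) × EuclideanSpace ℝ (Fin m)}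
    (h : LocallyExEquivalent Ξ x₀ (semiExplicit hl X₁ X₂ F₁ F₂ hF₁ hF₂) z₀) :
    ∃ (ψ : OpenPartialHomeomorph M (EuclideanSpace ℝ (Fin q) × EuclideanSpace ℝ (Fin m)))
      (Q : M → Matrix (Fin l) (Fin l) ℝ), x₀ ∈ ψ.source ∧ Ξ.Flattens ψ ∧
      IsSmoothGL (I := I) Q ψ.source ∧ ψ.target ⊆ (X₁ : Set _) ×ˢ (X₂ : Set _) ∧
      ∀ x ∈ ψ.source, (∀ v : TangentSpace I x, Q x *ᵥ Ξ.E x v =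
          stack hl (EuclideanSpace.equiv (Fin q) ℝ (coordDeriv I ψ x v).1) 0) ∧
        Q x *ᵥ Ξ.F x = stack hl (F₁ (ψ x)) (F₂ (ψ x)) := by
  obtain ⟨ψ, Q, hψ, hQ, hx₀, -, hX, hX', hE⟩ := h
  have hQE : ∀ x ∈ ψ.source, ∀ v : TangentSpace I x, Q x *ᵥ Ξ.E x v =
      stack hl (EuclideanSpace.equiv (Fin q) ℝ (coordDeriv I ψ x v).1) 0 :=
    fun x hx v => ((hE x hx).1 v).symm
  refine ⟨ψ, Q, hx₀, ⟨hψ, hX, fun x hx v => ?_⟩, hQ, hX', fun x hx =>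
    ⟨hQE x hx, (hE x hx).2.symm⟩⟩
  have h1 : Q x *ᵥ Ξ.E x v = 0 ↔ Ξ.E x v = 0 :=
    ⟨fun h2 => Matrix.mulVec_injective_iff_isUnit.2 (hQ.2 x hx)
      (h2.trans (Matrix.mulVec_zero _).symm),
      fun h2 => by rw [h2, Matrix.mulVec_zero]⟩
  rw [← h1, hQE x hx v, stack_zero_eq_zero_iff]
  exact ContinuousLinearEquiv.map_eq_zero_iff _

/-- A DAE that is locally externally equivalent to a semi-explicit one has an explicitation. -/
theorem LocallyExEquivalent.exists_isExplicitation [CompleteSpace V] {hl : q + p = l}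
    {X₁ : TopologicalSpace.Opens (EuclideanSpace ℝ (Fin q))}
    {X₂ : TopologicalSpace.Opens (EuclideanSpace ℝ (Fin m))}
    {F₁ : EuclideanSpace ℝ (Fin q) × EuclideanSpace ℝ (Fin m) → Fin q → ℝ}
    {F₂ : EuclideanSpace ℝ (Fin q) × EuclideanSpace ℝ (Fin m) → Fin p → ℝ}
    {hF₁ : ContDiffOn ℝ ∞ F₁ ((X₁ : Set _) ×ˢ (X₂ : Set _))}
    {hF₂ : ContDiffOn ℝ ∞ F₂ ((X₁ : Set _) ×ˢ (X₂ : Set _))} {x₀ : M}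
    {z₀ : EuclideanSpace ℝ (Fin q) × EuclideanSpace ℝ (Fin m)}
    (h : LocallyExEquivalent Ξ x₀ (semiExplicit hl X₁ X₂ F₁ F₂ hF₁ hF₂) z₀)
    (hn : q + m = Module.finrank ℝ V) :
    ∃ S : ControlSystem I M m p, IsExplicitation Ξ x₀ S := by
  obtain ⟨ψ, Q, hx₀, hΞ, hQ, hX', hE⟩ := h.exists_flattens
  let Y := EuclideanSpace ℝ (Fin q)
  let N := EuclideanSpace ℝ (Fin q) × EuclideanSpace ℝ (Fin m)
  let eY : Y ≃L[ℝ] (Fin q → ℝ) := EuclideanSpace.equiv (Fin q) ℝ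
  let j : (Fin q → ℝ) →L[ℝ] N := (ContinuousLinearMap.inl ℝ _ _).comp (eY.symm : _ →L[ℝ] Y)
  have hψ := hΞ.isLocalDiffeo
  have hW : IsOpen ((X₁ : Set Y) ×ˢ (X₂ : Set (EuclideanSpace ℝ (Fin m)))) :=
    X₁.isOpen.prod X₂.isOpen
  have hsub : ψ.source ⊆ ψ.source ∩ ψ ⁻¹' ((X₁ : Set _) ×ˢ (X₂ : Set _)) :=
    fun x hx => ⟨hx, hX' (ψ.map_source hx)⟩
  have hpull : ∀ {T : N → N}, ContDiffOn ℝ ∞ T ((X₁ : Set _) ×ˢ (X₂ : Set _)) →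
      ContMDiffOn I I.tangent ∞
        (fun x => (⟨x, mpullback I 𝓘(ℝ, N) ψ T x⟩ : TangentBundle I M)) ψ.source :=
    fun hT => (hψ.contMDiffOn_mpullback hW (contMDiffOn_vectorSpace_iff_contDiffOn.2 hT)).mono hsub
  have hpull_apply : ∀ (T : N → N), ∀ x ∈ ψ.source,
      coordDeriv I ψ x (mpullback I 𝓘(ℝ, N) ψ T x) = T (ψ x) :=
    fun T x hx => (hψ.isInvertible hx).self_apply_inverse _
  -- In the chart the drift is `(F₁, 0)` and the inputs act along the `∂/∂x₂ⁱ`; the right inverse of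
  -- `E₁ = dx₁` is `a ↦ (a, 0)`.
  let S : ControlSystem I M m p :=
    { X := ψ.source
      isOpen_X := ψ.open_source
      f := mpullback I 𝓘(ℝ, N) ψ fun z : N => (j (F₁ z) : N)
      g := fun i => mpullback I 𝓘(ℝ, N) ψ fun _ : N => ((0, EuclideanSpace.single i 1) : N)
      h := fun x => F₂ (ψ x)
      smooth_f := hpull (j.contDiff.comp_contDiffOn hF₁)
      smooth_g := fun i => hpull contDiffOn_const
      smooth_h := (hF₂.mono hX').contMDiffOn.comp hψ.1 fun x hx => ψ.map_source hx }
  refine ⟨S, hx₀, hΞ.source_subset, q, hl, Q,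
    fun x => (eY : Y →L[ℝ] (Fin q → ℝ)).comp ((ContinuousLinearMap.fst ℝ _ _).comp
      (coordDeriv I ψ x)), fun x => F₁ (ψ x),
    fun x => ContinuousLinearMap.comp (mfderiv I 𝓘(ℝ, N) ψ x).inverse j, hn, hQ,
    fun w => hpull contDiffOn_const, fun x hx =>
    ⟨(hE x hx).1, (hE x hx).2, fun w => ?_, rfl, le_antisymm (Submodule.span_le.2 ?_) ?_⟩⟩
  · have h1 := hpull_apply (fun _ => j w) x hx
    exact (congrArg (fun u : N => eY u.1) h1).trans (eY.apply_symm_apply w)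
  · rintro _ ⟨i, rfl⟩
    refine (hΞ.apply_eq_zero_iff x hx _).2 ?_
    exact congrArg Prod.fst (hpull_apply (fun _ => ((0, EuclideanSpace.single i 1) : N)) x hx)
  · intro v hv
    have hv1 := (hΞ.apply_eq_zero_iff x hx v).1 hv
    have h2 : v = ∑ i, (coordDeriv I ψ x v).2 i • S.g i x := by
      refine (hΞ.equiv hx).injective ?_
      rw [map_sum]
      refine (euclidean_prod_eq_sum _ hv1).trans (Finset.sum_congr rfl fun i _ => ?_)
      rw [map_smul]
      exact congrArg _
        (hpull_apply (fun _ => ((0, EuclideanSpace.single i 1) : N)) x hx).symm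
    rw [h2]
    exact Submodule.sum_mem _ fun i _ => Submodule.smul_mem _ _ (Submodule.subset_span ⟨i, rfl⟩)

theorem InvolutiveOn.congr {D D' : Distribution I M} {U : Set M} (h : InvolutiveOn D U)
    (hD : ∀ x ∈ U, D x = D' x) : InvolutiveOn D' U := by
  intro W hW hWU Y Z hY hZ hYD hZD x hx
  rw [← hD x (hWU hx)]
  exact h W hW hWU Y Z hY hZ (fun x hx => hD x (hWU hx) ▸ hYD x hx)
    (fun x hx => hD x (hWU hx) ▸ hZD x hx) x hx

/-- The `x₂`-part of `dψ` is an isomorphism on the kernel. Compared with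
`IsExplicitation.finrank_kerE`, this forces every explicitation to have as many inputs as the chart
has `x₂`-coordinates. -/
theorem DAE.Flattens.finrank_kerE [FiniteDimensional ℝ V]
    {ψ : OpenPartialHomeomorph M (EuclideanSpace ℝ (Fin q) × EuclideanSpace ℝ (Fin m))}
    (h : Ξ.Flattens ψ) {x : M} (hx : x ∈ ψ.source) : Module.finrank ℝ (Ξ.kerE x) = m := by
  let e : Ξ.kerE x ≃ₗ[ℝ] EuclideanSpace ℝ (Fin m) :=
    LinearEquiv.ofBijective
      ((LinearMap.snd ℝ (EuclideanSpace ℝ (Fin q)) (EuclideanSpace ℝ (Fin m))).comp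
        ((coordDeriv I ψ x : TangentSpace I x →ₗ[ℝ]
        EuclideanSpace ℝ (Fin q) × EuclideanSpace ℝ (Fin m)).comp (Ξ.kerE x).subtype)) (by
      constructor
      · rw [injective_iff_map_eq_zero]
        rintro ⟨v, hv⟩ hv2
        have hv1 := (h.apply_eq_zero_iff x hx v).1 hv
        exact Subtype.ext ((h.equiv hx).map_eq_zero_iff.1 (Prod.ext hv1 hv2))
      · intro w
        have h1 := (h.equiv hx).apply_symm_apply (0, w)
        exact ⟨⟨(h.equiv hx).symm (0, w),
          (h.apply_eq_zero_iff x hx _).2 (congrArg Prod.fst h1)⟩, congrArg Prod.snd h1⟩)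
  rw [e.finrank_eq, finrank_euclideanSpace_fin]

/-- The number of inputs of an explicitation is the dimension of the kernel of `E`. -/
theorem IsExplicitation.finrank_kerE [FiniteDimensional ℝ V] {S : ControlSystem I M m p} {x₀ : M}
    (hS : IsExplicitation Ξ x₀ S) : Module.finrank ℝ (Ξ.kerE x₀) = m := by
  obtain ⟨hx₀, -, q, hl, Q, E₁, F₁, E₁r, hn, hQ, -, hE⟩ := hS
  obtain ⟨hQE, -, hr, -, -⟩ := hE x₀ hx₀
  have hker : Ξ.kerE x₀ = LinearMap.ker (E₁ x₀ : TangentSpace I x₀ →ₗ[ℝ] (Fin q → ℝ)) := by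
    ext v
    change Ξ.E x₀ v = 0 ↔ E₁ x₀ v = 0
    rw [← stack_zero_eq_zero_iff hl, ← hQE v]
    exact ⟨fun h2 => by rw [h2, Matrix.mulVec_zero], fun h2 =>
      Matrix.mulVec_injective_iff_isUnit.2 (hQ.2 x₀ hx₀) (h2.trans (Matrix.mulVec_zero _).symm)⟩
  have : FiniteDimensional ℝ (TangentSpace I x₀) := inferInstanceAs (FiniteDimensional ℝ V)
  have h1 := LinearMap.finrank_range_add_finrank_ker
    (E₁ x₀ : TangentSpace I x₀ →ₗ[ℝ] (Fin q → ℝ))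
  -- The right inverse makes `E₁` surjective, so its rank is `q` and its kernel has dimension `n - q
  -- = m`.
  rw [LinearMap.range_eq_top.2 fun w => ⟨E₁r x₀ w, hr w⟩, finrank_top, Module.finrank_fin_fun,
    ← hker] at h1
  have h2 : Module.finrank ℝ (TangentSpace I x₀) = Module.finrank ℝ V := rfl
  omega

/-- Every explicitation of a DAE whose kernel can be flattened can be fully reduced. -/
theorem DAE.Flattens.canBeFullyReduced [FiniteDimensional ℝ V]
    {ψ : OpenPartialHomeomorph M (EuclideanSpace ℝ (Fin q) × EuclideanSpace ℝ (Fin m))}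
    (h : Ξ.Flattens ψ) {x₀ : M} (hx₀ : x₀ ∈ ψ.source) (hn : q + m = Module.finrank ℝ V)
    {m' : ℕ} {S : ControlSystem I M m' p} (hS : IsExplicitation Ξ x₀ S) :
    CanBeFullyReduced S x₀ := by
  have : CompleteSpace V := FiniteDimensional.complete ℝ V
  obtain rfl : m' = m := hS.finrank_kerE.symm.trans (h.finrank_kerE hx₀)
  have hG : ∀ x ∈ S.X, S.G x = Ξ.kerE x := by
    obtain ⟨-, -, q', hl, Q, E₁, F₁, E₁r, -, -, -, hE⟩ := hS
    exact fun x hx => (hE x hx).2.2.2.2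
  let X := EuclideanSpace ℝ (Fin m')
  let N := EuclideanSpace ℝ (Fin q) × EuclideanSpace ℝ (Fin m')
  let eX : X ≃L[ℝ] (Fin m' → ℝ) := EuclideanSpace.equiv (Fin m') ℝ
  let φ := ψ.restrOpen S.X S.isOpen_X
  have hφ : Ξ.Flattens φ := h.restrOpen S.isOpen_X
  have hx₀φ : x₀ ∈ φ.source := ⟨hx₀, hS.1⟩
  have hφX : φ.source ⊆ S.X := Set.inter_subset_right
  have hGφ : ∀ x ∈ φ.source, S.G x = Ξ.kerE x := fun x hx => hG x (hφX hx)
  have hmem : ∀ x ∈ φ.source, ∀ v : TangentSpace I x, v ∈ S.G x ↔ (coordDeriv I φ x v).1 = 0 := by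
    intro x hx v
    rw [hGφ x hx]
    exact hφ.apply_eq_zero_iff x hx v
  have hder : ∀ {T : VField I M},
      ContMDiffOn I I.tangent ∞ (fun x => (⟨x, T x⟩ : TangentBundle I M)) S.X →
      ContMDiffOn I 𝓘(ℝ, N) ∞ (fun x => coordDeriv I φ x (T x)) φ.source :=
    fun hT => contMDiffOn_mfderiv_apply φ.open_source hφ.isLocalDiffeo.1 (hT.mono hφX)
  let sndX : N →L[ℝ] (Fin m' → ℝ) := (eX : X →L[ℝ] (Fin m' → ℝ)).comp
    (ContinuousLinearMap.snd ℝ _ _)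
  -- The matrix of `g` in the `x₂`-coordinates. It is onto because the `g` span `ker E`, hence
  -- invertible as a square matrix.
  let γ : M → (Fin m' → ℝ) →L[ℝ] (Fin m' → ℝ) := fun x =>
    ∑ a, (ContinuousLinearMap.proj a : (Fin m' → ℝ) →L[ℝ] ℝ).smulRight
      (sndX (coordDeriv I φ x (S.g a x)))
  have hγ_apply : ∀ x c, γ x c = sndX (coordDeriv I φ x (∑ a, c a • S.g a x)) := by
    intro x c
    rw [map_sum, map_sum]
    simp only [γ, sum_apply, map_smul]
    rfl
  have hγs : ContMDiffOn I 𝓘(ℝ, (Fin m' → ℝ) →L[ℝ] (Fin m' → ℝ)) ∞ γ φ.source := by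
    refine contMDiffOn_clm_of_apply fun c => ?_
    have h1 : ∀ a, ContMDiffOn I 𝓘(ℝ, Fin m' → ℝ) ∞
        (fun x => c a • sndX (coordDeriv I φ x (S.g a x))) φ.source := fun a =>
      (c a • sndX).contMDiff.comp_contMDiffOn (hder (S.smooth_g a))
    refine (contMDiffOn_finsetSum (t := Finset.univ) fun a _ => h1 a).congr fun x _ => ?_
    simp only [γ, sum_apply]
    rfl
  have hγinv : ∀ x ∈ φ.source, (γ x).IsInvertible := by
    intro x hx
    have hsurj : Function.Surjective (γ x : (Fin m' → ℝ) →ₗ[ℝ] (Fin m' → ℝ)) := by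
      intro w
      have h1 := (hφ.equiv hx).apply_symm_apply (0, eX.symm w)
      obtain ⟨c, hc⟩ := (Submodule.mem_span_range_iff_exists_fun ℝ).1
        ((hmem x hx ((hφ.equiv hx).symm (0, eX.symm w))).2 (congrArg Prod.fst h1))
      refine ⟨c, ?_⟩
      change γ x c = w
      rw [hγ_apply, hc]
      exact (congrArg sndX h1).trans (eX.apply_symm_apply w)
    exact ⟨(LinearEquiv.ofInjectiveEndo _
      (LinearMap.injective_iff_surjective.2 hsurj)).toContinuousLinearEquiv, rfl⟩
  have hcol : ∀ x ∈ φ.source, ∀ c : Fin m' → ℝ,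
      coordDeriv I φ x (∑ a, c a • S.g a x) = (0, eX.symm (γ x c)) := by
    intro x hx c
    refine Prod.ext ?_ ?_
    · refine (hmem x hx _).1 (Submodule.sum_mem _ fun a _ => Submodule.smul_mem _ _ ?_)
      exact Submodule.subset_span ⟨a, rfl⟩
    · rw [hγ_apply]
      exact (eX.symm_apply_apply _).symm
  have hcomp : ∀ {F : Type} [NormedAddCommGroup F] [NormedSpace ℝ F] {f : M → F},
      ContMDiffOn I 𝓘(ℝ, F) ∞ f φ.source → ContDiffOn ℝ ∞ (fun z => f (φ.symm z)) φ.target := by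
    intro F _ _ f hf
    rw [← contMDiffOn_iff_contDiffOn]
    exact hf.comp hφ.isLocalDiffeo.2 fun z hz => φ.map_target hz
  -- Here `k` equals the number of inputs, so no `v₁` remains and `g₁` is an empty family. The
  -- feedback is `β = γ⁻¹` and `α = -γ⁻¹ (dφ f)₂`.
  refine ⟨m', ⟨φ.source, φ.open_source, hx₀φ, hφX, hφ.involutiveOn.congr fun x hx =>
    (hGφ x hx).symm, fun x hx => ⟨le_rfl, ?_⟩⟩, le_rfl, q, φ,
    fun x => -(γ x).inverse (sndX (coordDeriv I φ x (S.f x))),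
    fun x => LinearMap.toMatrix' ((γ x).inverse : (Fin m' → ℝ) →ₗ[ℝ] (Fin m' → ℝ)),
    fun z => (coordDeriv I φ (φ.symm z) (S.f (φ.symm z))).1, fun _ _ => 0,
    fun z => S.h (φ.symm z), hn, hφ.isLocalDiffeo, hx₀φ, hφX,
    ((contMDiffOn_clm_inverse hγs hγinv).clm_apply
      (sndX.contMDiff.comp_contMDiffOn (hder S.smooth_f))).neg,
    isSmoothGL_inverse hγs hγinv, contDiff_fst.comp_contDiffOn (hcomp (hder S.smooth_f)),
    fun _ => contDiffOn_const, hcomp (S.smooth_h.mono hφX), ?_⟩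
  · rw [hGφ x hx]
    exact hφ.finrank_kerE hx
  · rintro x hx _ rfl
    refine ⟨hmem x hx, ?_, fun i => absurd i.2 (by omega), fun j => ?_, ?_⟩
    · change coordDeriv I φ x (S.f x + ∑ a,
          (-(γ x).inverse (sndX (coordDeriv I φ x (S.f x)))) a • S.g a x) =
        ((coordDeriv I φ (φ.symm (φ x)) (S.f (φ.symm (φ x)))).1, 0)
      rw [φ.left_inv hx, map_add, hcol x hx, map_neg, (hγinv x hx).self_apply_inverse]
      refine Prod.ext (add_zero _) ?_
      change (coordDeriv I φ x (S.f x)).2 + eX.symm (-(eX (coordDeriv I φ x (S.f x)).2)) = 0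
      rw [map_neg, eX.symm_apply_apply, add_neg_cancel]
    · have hj : (⟨m' - m' + j, by omega⟩ : Fin m') = j := Fin.ext (by simp)
      have h1 : ∀ a, LinearMap.toMatrix' ((γ x).inverse : (Fin m' → ℝ) →ₗ[ℝ] (Fin m' → ℝ)) a j =
          (γ x).inverse (Pi.single j 1) a := by
        intro a
        rw [LinearMap.toMatrix'_apply]
        rfl
      simp only [hj, h1]
      refine (hcol x hx _).trans ?_
      rw [(hγinv x hx).self_apply_inverse]
      rfl
    · exact (congrArg S.h (φ.left_inv hx)).symm

end Explicitation

end NonlinearDAE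

end

/-! ### The equivalence. -/

open NonlinearDAE

theorem mainTheorem2 {n l : ℕ} {M : Type*} [TopologicalSpace M]
    [ChartedSpace (EuclideanSpace ℝ (Fin n)) M] [IsManifold (𝓡 n) ∞ M]
    (Ξ : DAE (𝓡 n) M l) (xp : M) (hxp : xp ∈ Ξ.X) :
    List.TFAE [
      -- (i)
      (∃ U : Set M, IsOpen U ∧ xp ∈ U ∧ U ⊆ Ξ.X ∧
        (∃ q : ℕ, ∀ x ∈ U, Ξ.rankE x = q) ∧ InvolutiveOn Ξ.kerE U),
      -- (ii)
      (∃ (q m p : ℕ) (hl : q + p = l) (_ : q + m = n)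
        (X₁ : TopologicalSpace.Opens (EuclideanSpace ℝ (Fin q)))
        (X₂ : TopologicalSpace.Opens (EuclideanSpace ℝ (Fin m)))
        (F₁ : EuclideanSpace ℝ (Fin q) × EuclideanSpace ℝ (Fin m) → Fin q → ℝ)
        (F₂ : EuclideanSpace ℝ (Fin q) × EuclideanSpace ℝ (Fin m) → Fin p → ℝ)
        (hF₁ : ContDiffOn ℝ ∞ F₁ ((X₁ : Set _) ×ˢ (X₂ : Set _)))
        (hF₂ : ContDiffOn ℝ ∞ F₂ ((X₁ : Set _) ×ˢ (X₂ : Set _)))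
        (zp : EuclideanSpace ℝ (Fin q) × EuclideanSpace ℝ (Fin m)),
        LocallyExEquivalent Ξ xp (semiExplicit hl X₁ X₂ F₁ F₂ hF₁ hF₂) zp),
      -- (iii)
      (∃ (m p : ℕ) (S : ControlSystem (𝓡 n) M m p), IsExplicitation Ξ xp S) ∧
        ∀ (m p : ℕ) (S : ControlSystem (𝓡 n) M m p),
          IsExplicitation Ξ xp S → CanBeFullyReduced S xp] := by
  have hV : Module.finrank ℝ (EuclideanSpace ℝ (Fin n)) = n := finrank_euclideanSpace_fin
  tfae_have 1 → 2 := by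
    rintro ⟨U, hU, hxU, hUX, ⟨q, hq⟩, hinv⟩
    obtain ⟨m, ψ, hqm, hx, hψ⟩ := exists_flattens Ξ hU hxU hUX hq hinv
    obtain ⟨p, hl, h⟩ := hψ.exists_semiExplicit hx
    exact ⟨q, m, p, hl, hqm, h⟩
  tfae_have 2 → 3 := by
    rintro ⟨q, m, p, hl, hqm, X₁, X₂, F₁, F₂, hF₁, hF₂, zp, h⟩
    refine ⟨⟨m, p, h.exists_isExplicitation (hqm.trans hV.symm)⟩, fun m' p' S hS => ?_⟩
    obtain ⟨ψ, -, hx, hψ, -⟩ := h.exists_flattens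
    exact hψ.canBeFullyReduced hx (hqm.trans hV.symm) hS
  tfae_have 3 → 1 := by
    -- Existence of an explicitation is essential, since otherwise the second half of (iii) could
    -- hold vacuously. Of its reduction only involutivity and constant rank of `𝒢` are used, not the
    -- normal form.
    rintro ⟨⟨m, p, S, hS⟩, h⟩
    obtain ⟨k, ⟨U, hU, hxU, hUX, hinv, hG⟩, -⟩ := h m p S hS
    obtain ⟨-, hSX, q, hl, Q, E₁, F₁, E₁r, -, -, -, hE⟩ := hS
    have hGE : ∀ x ∈ U, S.G x = Ξ.kerE x := fun x hx => (hE x (hUX hx)).2.2.2.2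
    refine ⟨U, hU, hxU, hUX.trans hSX, ⟨n - k, fun x hx => ?_⟩, hinv.congr hGE⟩
    have h1 := (hG x hx).2
    rw [hGE x hx] at h1
    have : FiniteDimensional ℝ (TangentSpace (𝓡 n) x) :=
      inferInstanceAs (FiniteDimensional ℝ (EuclideanSpace ℝ (Fin n)))
    have h2 : Ξ.rankE x + Module.finrank ℝ (Ξ.kerE x) = n :=
      (LinearMap.finrank_range_add_finrank_ker
        (Ξ.E x : TangentSpace (𝓡 n) x →ₗ[ℝ] (Fin l → ℝ))).trans hV
    omega
  tfae_finish
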